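/- Let $p_1,p_2>0$, let $p(x)=p_1$ on $[-\pi,0)$ and $p(x)=p_2$ on $(0,\pi]$, let $q$ be a real-valued function that is continuous on $[-\pi,0)$ and on $(0,\pi]$ and has finite one-sided limits $q(0\mp)$, and let $\alpha,\beta$ and $\beta^{\pm}_{ij}$ ($i=1,2$, $j=0,1$) be real numbers. Consider the boundary value transmission problem $$-p(x)y''(x)+q(x)y(x)=\lambda y(x),\qquad x\in[-\pi,0)\cup(0,\pi],$$ $$\cos\alpha\, y(-\pi)+\sin\alpha\, y'(-\pi)=0,\qquad \cos\beta\, y(\pi)+\sin\beta\, y'(\pi)=0,$$ $$\beta^{-}_{i1}y'(0-)+\beta^{-}_{i0}y(0-)+\beta^{+}_{i1}y'(0+)+\beta^{+}_{i0}y(0+)=0,\qquad i=1,2,$$ with complex eigenparameter $\lambda$, where the one-sided limits $y(0\pm)$, $y'(0\pm)$ are required to exist and the derivatives at $\pm\pi$ are one-sided. Put $$\Delta_{12}=\beta^+_{10}\beta^+_{21}-\beta^+_{11}\beta^+_{20},\qquad \Delta_{34}=\beta^-_{10}\beta^-_{21}-\beta^-_{11}\beta^-_{20},$$ assume $\Delta_{12}>0$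 and $\Delta_{34}>0$, and let $$\langle u,v\rangle=\frac{\Delta_{34}}{p_1}\int_{-\pi}^{0}u(x)v(x)\,dx+\frac{\Delta_{12}}{p_2}\int_{0}^{\pi}u(x)v(x)\,dx .$$ Then the eigenvalues of the problem are real and can be listed as a sequence $\lambda_0,\lambda_1,\lambda_2,\dots$ in which each eigenvalue occurs exactly once, and each $\lambda_n$ has a real-valued eigenfunction $\varphi_n$ with $\langle\varphi_n,\varphi_n\rangle=1$. Moreover, for every such sequence of eigenvalues and every such choice of normalized eigenfunctions: 1. $\langle\varphi_n,\varphi_m\rangle=\delta_{nm}$ for all $n,m\ge 0$. 2. For every real-valued square-integrable function $f$ on $[-\pi,0)\cup(0,\pi]$, with $c_k(f)=\langle f,\varphi_k\rangle$, $$\lim_{n\to\infty}\Big\{\frac{\Delta_{34}}{p_1}\int_{-\pi}^{0}\Big(f(x)-\sum_{k=0}^{n}c_k(f)\varphi_k(x)\Big)^{2}dx+\frac{\Delta_{12}}{p_2}\int_{0}^{\pi}\Big(f(x)-\sum_{k=0}^{n}c_k(f)\varphi_k(x)\Big)^{2}dx\Big\}=0 .$$ 3. $(\varphi_n)_{n\ge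 0}$ is a complete orthonormal system (Hilbert basis) of the modified Hilbert space, that is, of the real space of square-integrable functions on $[-\pi,0)\cup(0,\pi]$ (modulo equality almost everywhere) with inner product $\langle\cdot,\cdot\rangle$. -/

import Mathlib

open Set Filter Topology MeasureTheory

namespace TwoIntervalSL

/-- The set `[-π, 0) ∪ (0, π]` on which all functions of the problem live. Functions are represented
by total functions on `ℝ`; only their values on this set matter. -/
def J : Set ℝ := Ico (-Real.pi) 0 ∪ Ioc 0 Real.pi

/-- The data of the two-interval Sturm-Liouville problem
`-p y'' + q y = lam y` on `[-π, 0) ∪ (0, π]`,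
`cos α y(-π) + sin α y'(-π) = 0`, `cos β y(π) + sin β y'(π) = 0`,
`bm i 1 y'(0-) + bm i 0 y(0-) + bp i 1 y'(0+) + bp i 0 y(0+) = 0` for the two indices `i`.
The row index `i = 0, 1` of `bm`, `bp` numbers the two transmission conditions, and the column index
is the order of the derivative. -/
structure Problem where
  p₁ : ℝ
  p₂ : ℝ
  p₁_pos : 0 < p₁
  p₂_pos : 0 < p₂
  q : ℝ → ℝ
  q_continuousOn : ContinuousOn q J
  q_left : ∃ l : ℝ, Tendsto q (𝓝[<] 0) (𝓝 l)
  q_right : ∃ r : ℝ, Tendsto q (𝓝[>] 0) (𝓝 r)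
  α : ℝ
  β : ℝ
  bm : Fin 2 → Fin 2 → ℝ
  bp : Fin 2 → Fin 2 → ℝ

namespace Problem

/-- The piecewise constant leading coefficient. -/
noncomputable def p (P : Problem) (x : ℝ) : ℝ := if x < 0 then P.p₁ else P.p₂

/-- The matrix of the transmission conditions, with columns
`β⁺ᵢ₀, β⁺ᵢ₁, β⁻ᵢ₀, β⁻ᵢ₁`. -/
def T (P : Problem) : Matrix (Fin 2) (Fin 4) ℝ :=
  !![P.bp 0 0, P.bp 0 1, P.bm 0 0, P.bm 0 1;
     P.bp 1 0, P.bp 1 1, P.bm 1 0, P.bm 1 1]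

/-- The determinant of the first and second columns of `T`. -/
def Δ₁₂ (P : Problem) : ℝ := (P.T.submatrix id ![0, 1]).det

/-- The determinant of the third and fourth columns of `T`. -/
def Δ₃₄ (P : Problem) : ℝ := (P.T.submatrix id ![2, 3]).det

/-- `y` solves the boundary value transmission problem with parameter `lam`. Here `y'`, `y''` are the
first two derivatives of `y` on `J` (one-sided at `±π`), and `yl, yl', yr, yr'` are the one-sided
limits `y(0-), y'(0-), y(0+), y'(0+)`. -/
structure IsSolutionWith {𝕜 : Type} [RCLike 𝕜] (P : Problem) (lam : 𝕜) (y y' y'' : ℝ → 𝕜)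
    (yl yl' yr yr' : 𝕜) : Prop where
  deriv_one : ∀ x ∈ J, HasDerivWithinAt y (y' x) J x
  deriv_two : ∀ x ∈ J, HasDerivWithinAt y' (y'' x) J x
  equation : ∀ x ∈ J, -(P.p x • y'' x) + P.q x • y x = lam * y x
  boundary_left : Real.cos P.α • y (-Real.pi) + Real.sin P.α • y' (-Real.pi) = 0
  boundary_right : Real.cos P.β • y Real.pi + Real.sin P.β • y' Real.pi = 0
  tendsto_left : Tendsto y (𝓝[<] 0) (𝓝 yl)
  tendsto_left' : Tendsto y' (𝓝[<] 0) (𝓝 yl')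
  tendsto_right : Tendsto y (𝓝[>] 0) (𝓝 yr)
  tendsto_right' : Tendsto y' (𝓝[>] 0) (𝓝 yr')
  transmission : ∀ i : Fin 2,
    P.bm i 1 • yl' + P.bm i 0 • yl + P.bp i 1 • yr' + P.bp i 0 • yr = 0

/-- `y` is an eigenfunction (with values in `𝕜 = ℝ` or `ℂ`) for the eigenvalue `lam`. -/
def IsEigenfunction {𝕜 : Type} [RCLike 𝕜] (P : Problem) (lam : 𝕜) (y : ℝ → 𝕜) : Prop :=
  (∃ (y' y'' : ℝ → 𝕜) (yl yl' yr yr' : 𝕜), P.IsSolutionWith lam y y' y'' yl yl' yr yr') ∧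
    ∃ x ∈ J, y x ≠ 0

/-- The set of complex numbers for which the problem has a (complex-valued) eigenfunction. -/
def eigenvalues (P : Problem) : Set ℂ := {lam | ∃ y : ℝ → ℂ, P.IsEigenfunction lam y}

/-- The modified inner product
`Δ₃₄ / p₁ * ∫_{-π}^0 u v + Δ₁₂ / p₂ * ∫_0^π u v`. -/
noncomputable def inn (P : Problem) (u v : ℝ → ℝ) : ℝ :=
  P.Δ₃₄ / P.p₁ * (∫ x in (-Real.pi)..0, u x * v x) +
    P.Δ₁₂ / P.p₂ * ∫ x in (0 : ℝ)..Real.pi, u x * v x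

/-- The measure whose `L²` space is the modified Hilbert space (for `Δ₁₂, Δ₃₄ > 0`). -/
noncomputable def weight (P : Problem) : Measure ℝ :=
  ENNReal.ofReal (P.Δ₃₄ / P.p₁) • volume.restrict (Ico (-Real.pi) 0) +
    ENNReal.ofReal (P.Δ₁₂ / P.p₂) • volume.restrict (Ioc 0 Real.pi)

/-- `lam 0, lam 1, …` lists all the eigenvalues, each exactly once, and `φ n` is a real eigenfunction
for `lam n` that is normalized in the modified inner product. -/
structure IsEigensystem (P : Problem) (lam : ℕ → ℝ) (φ : ℕ → ℝ → ℝ) : Prop where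
  injective : Function.Injective lam
  range_eq : range (fun n => (lam n : ℂ)) = P.eigenvalues
  eigenfunction : ∀ n, P.IsEigenfunction (lam n) (φ n)
  normalized : ∀ n, P.inn (φ n) (φ n) = 1

end Problem

end TwoIntervalSL

/-!
# Completeness of the eigenfunctions of a two-interval Sturm-Liouville problem

The transmission conditions multiply the Wronskian at `0-` by `Δ₃₄ / Δ₁₂` on the way to `0+`
(`Problem.Transmits.wronskian`). With the weights `Δ₃₄ / p₁` and `Δ₁₂ / p₂` the boundary terms in
Lagrange's identity therefore cancel, and the problem is symmetric for the modified inner product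
(`Problem.Solves.inn_eq`). Consequently eigenvalues are real
(`Problem.exists_real_of_mem_eigenvalues`) and eigenfunctions for different eigenvalues are
orthogonal. Eigenvalues are simple because Cauchy data at `-π` determine a solution on both
intervals (`Problem.Solves.exists_eq_const_mul`).

As the modified Hilbert space is separable, there are at most countably many eigenvalues, so some
real `lam` is not one. For such a `lam` the problem `-p y'' + q y = lam y + f` is solved by a Green's
function, a bounded symmetric kernel made of one solution satisfying the left and one satisfying the
right boundary condition (`Problem.exists_greenKernel`). The integral operator with this kernel is
Hilbert-Schmidt, hence compact (`exists_compact_symmetric_integralOperator`), and injective, because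
its range contains all test functions. Its eigenvectors are the eigenfunctions of the problem, so
the spectral theorem for compact symmetric operators shows that a function orthogonal to all
eigenfunctions vanishes (`Problem.eq_zero_of_forall_inner_eq_zero`). In particular the eigenfunctions
span an infinite-dimensional space, hence there are infinitely many eigenvalues, and any normalized
eigensystem is a Hilbert basis; the mean square convergence is the expansion in this basis.
-/

namespace TwoIntervalSL

/-! ### Linear second order equations -/

/-- Two functions with `y' = y₁`, `y₁' = Q y` and prescribed values at the left end point. The
existence theorem of Picard and Lindelöf is only local, so the vector field is truncated to a
bounded one; by Grönwall's inequality the solution never reaches the truncated region. -/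
theorem exists_solution_of_left_data {a b : ℝ} (hab : a < b) {Q : ℝ → ℝ}
    (hQ : ContinuousOn Q (Icc a b)) (c d : ℝ) :
    ∃ y y₁ : ℝ → ℝ, y a = c ∧ y₁ a = d ∧
      ∀ t ∈ Icc a b, HasDerivWithinAt y (y₁ t) (Icc a b) t ∧
        HasDerivWithinAt y₁ (Q t * y t) (Icc a b) t := by
  obtain ⟨M₀, hM₀⟩ := isCompact_Icc.exists_bound_of_continuousOn hQ
  obtain ⟨M, hM1, hM⟩ : ∃ M : ℝ, 1 ≤ M ∧ ∀ t ∈ Icc a b, |Q t| ≤ M :=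
    ⟨max 1 M₀, le_max_left _ _, fun t ht => (hM₀ t ht).trans (le_max_right _ _)⟩
  have hM0 : 0 ≤ M := by linarith
  set x₀ : ℝ × ℝ := (c, d)
  set R : ℝ := ‖x₀‖ * Real.exp (M * (b - a)) with hR
  have hR0 : 0 ≤ R := by positivity
  let clip : ℝ → ℝ := fun x => max (-R) (min R x)
  have clip_le : ∀ x, |clip x| ≤ |x| := by
    intro x
    simp only [clip]
    rcases max_cases (-R) (min R x) with h | h <;> rcases min_cases R x with h' | h' <;>
      rcases abs_cases x with h'' | h'' <;> rw [abs_le] <;> constructor <;> linarith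
  have clip_le' : ∀ x, |clip x| ≤ R := by
    intro x
    simp only [clip]
    rcases max_cases (-R) (min R x) with h | h <;> rcases min_cases R x with h' | h' <;>
      rw [abs_le] <;> constructor <;> linarith
  have clip_eq : ∀ x, |x| ≤ R → clip x = x := by
    intro x hx
    rw [abs_le] at hx
    simp only [clip, min_eq_right hx.2, max_eq_right hx.1]
  have clip_lip : ∀ x y, |clip x - clip y| ≤ |x - y| := by
    intro x y
    have h : LipschitzWith 1 clip := (LipschitzWith.id.const_min R).const_max (-R)
    simpa [Real.dist_eq] using h.dist_le_mul x y
  let v : ℝ → ℝ × ℝ → ℝ × ℝ := fun t x => (clip x.2, Q t * clip x.1)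
  have hvR : ∀ t ∈ Icc a b, ∀ x, ‖v t x‖ ≤ M * R := by
    intro t ht x
    refine max_le ?_ ?_
    · simpa using mul_le_mul hM1 (clip_le' x.2) (abs_nonneg _) hM0
    · simp only [v, Real.norm_eq_abs, abs_mul]
      exact mul_le_mul (hM t ht) (clip_le' x.1) (abs_nonneg _) hM0
  have hvx : ∀ t ∈ Icc a b, ∀ x, ‖v t x‖ ≤ M * ‖x‖ := by
    intro t ht x
    refine max_le ?_ ?_
    · simpa using mul_le_mul hM1 ((clip_le x.2).trans (norm_snd_le x)) (abs_nonneg _) hM0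
    · simp only [v, Real.norm_eq_abs, abs_mul]
      exact mul_le_mul (hM t ht) ((clip_le x.1).trans (norm_fst_le x)) (abs_nonneg _) hM0
  have hvL : ∀ t ∈ Icc a b, ∀ x y, ‖v t x - v t y‖ ≤ M * ‖x - y‖ := by
    intro t ht x y
    refine max_le ?_ ?_
    · simpa [v] using
        mul_le_mul hM1 ((clip_lip x.2 y.2).trans (norm_snd_le (x - y))) (abs_nonneg _) hM0
    · simp only [v, Prod.snd_sub, ← mul_sub, Real.norm_eq_abs, abs_mul]
      exact mul_le_mul (hM t ht) ((clip_lip x.1 y.1).trans (norm_fst_le (x - y)))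
        (abs_nonneg _) hM0
  have hA : (0 : ℝ) ≤ M * R * (b - a) := mul_nonneg (by positivity) (by linarith)
  have hPL : IsPicardLindelof v (tmin := a) (tmax := b) ⟨a, left_mem_Icc.2 hab.le⟩ x₀
      ⟨M * R * (b - a), hA⟩ 0 ⟨M * R, by positivity⟩ ⟨M, hM0⟩ := by
    refine ⟨fun t ht => LipschitzWith.lipschitzOnWith (LipschitzWith.of_dist_le_mul ?_), ?_, ?_, ?_⟩
    · intro x y
      rw [dist_eq_norm, dist_eq_norm]
      exact hvL t ht x y
    · intro x _
      exact continuousOn_const.prodMk (hQ.mul continuousOn_const)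
    · intro t ht x _
      exact hvR t ht x
    · simp only [sub_self, NNReal.coe_zero, sub_zero]
      rw [max_eq_left (by linarith)]
      exact le_rfl
  obtain ⟨s, hs0, hs⟩ := hPL.exists_eq_forall_mem_Icc_hasDerivWithinAt₀
  have hsR : ∀ t ∈ Icc a b, ‖s t‖ ≤ R := by
    intro t ht
    have := norm_le_gronwallBound_of_norm_deriv_right_le (f := s) (f' := fun t => v t (s t))
      (δ := ‖x₀‖) (K := M) (ε := 0) (a := a) (b := b)
      (fun t ht => (hs t ht).continuousWithinAt)
      (fun t ht => (hs t (Ico_subset_Icc_self ht)).mono_of_mem_nhdsWithin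
        (Icc_mem_nhdsGE_of_mem ht))
      (by rw [← hs0]) (fun t ht => by simpa using hvx t (Ico_subset_Icc_self ht) (s t)) t ht
    rw [gronwallBound_ε0] at this
    refine this.trans ?_
    rw [hR]
    gcongr
    exact ht.2
  refine ⟨fun t => (s t).1, fun t => (s t).2, congrArg Prod.fst hs0, congrArg Prod.snd hs0,
    fun t ht => ?_⟩
  have h1 := (hs t ht).fst
  have h2 := (hs t ht).snd
  simp only [v] at h1 h2
  rw [clip_eq _ ((norm_snd_le (s t)).trans (hsR t ht))] at h1
  rw [clip_eq _ ((norm_fst_le (s t)).trans (hsR t ht))] at h2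
  exact ⟨h1, h2⟩

/-- The pair `(y, y₁)` solves `y'' = Q y` on the interval `(-4, 4)`, which contains `[-π, π]`. -/
def SolvesODE (Q y y₁ : ℝ → ℝ) : Prop :=
  ∀ t ∈ Ioo (-4 : ℝ) 4, HasDerivAt y (y₁ t) t ∧ HasDerivAt y₁ (Q t * y t) t

/-- The initial value problem is solvable with data at any point. The data are reached by a linear
combination of two solutions with data at `-4`, whose Wronskian is constantly `1`. -/
theorem exists_solvesODE {Q : ℝ → ℝ} (hQ : Continuous Q) {t₀ : ℝ} (ht₀ : t₀ ∈ Ioo (-4 : ℝ) 4)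
    (c d : ℝ) : ∃ y y₁ : ℝ → ℝ, SolvesODE Q y y₁ ∧ y t₀ = c ∧ y₁ t₀ = d := by
  obtain ⟨u, u₁, hu, hu₁, H⟩ :=
    exists_solution_of_left_data (by norm_num : (-4 : ℝ) < 4) hQ.continuousOn 1 0
  obtain ⟨v, v₁, hv, hv₁, K⟩ :=
    exists_solution_of_left_data (by norm_num : (-4 : ℝ) < 4) hQ.continuousOn 0 1
  have hW : u t₀ * v₁ t₀ - u₁ t₀ * v t₀ = 1 := by
    have := constant_of_has_deriv_right_zero (f := fun t => u t * v₁ t - u₁ t * v t)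
      (a := -4) (b := 4) ?_ ?_ t₀ (Ioo_subset_Icc_self ht₀)
    · simpa [hu, hu₁, hv, hv₁] using this
    · intro t ht
      exact ((((H t ht).1.mul (K t ht).2).sub ((H t ht).2.mul (K t ht).1))).continuousWithinAt
    · intro t ht
      have ht' := Ico_subset_Icc_self ht
      have := (((H t ht').1.mul (K t ht').2).sub ((H t ht').2.mul (K t ht').1))
      have h2 := this.mono_of_mem_nhdsWithin (Icc_mem_nhdsGE_of_mem ht)
      refine h2.congr_deriv ?_
      ring
  refine ⟨fun t => (c * v₁ t₀ - d * v t₀) * u t + (d * u t₀ - c * u₁ t₀) * v t,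
    fun t => (c * v₁ t₀ - d * v t₀) * u₁ t + (d * u t₀ - c * u₁ t₀) * v₁ t, ?_, ?_, ?_⟩
  · intro t ht
    have ht' := Ioo_subset_Icc_self ht
    have hn := Icc_mem_nhds ht.1 ht.2
    refine ⟨(((H t ht').1.hasDerivAt hn).const_mul _).add
      (((K t ht').1.hasDerivAt hn).const_mul _), ?_⟩
    refine ((((H t ht').2.hasDerivAt hn).const_mul _).add
      (((K t ht').2.hasDerivAt hn).const_mul _)).congr_deriv ?_
    ring
  · linear_combination c * hW
  · linear_combination d * hW

/-! ### Compactness of bounded integral operators -/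

/-- An operator with `∑ ‖T bᵢ‖² < ∞` on a Hilbert basis (a Hilbert-Schmidt operator) is compact: it
is the sum of the rank one operators `⟪bᵢ, ·⟫ T bᵢ`, and the Cauchy-Schwarz inequality bounds the
norm of a finite partial sum by the square root of `∑ ‖T bᵢ‖²`. -/
theorem isCompactOperator_of_sum_sq_le {H : Type*} [NormedAddCommGroup H] [InnerProductSpace ℝ H]
    [CompleteSpace H] (T : H →L[ℝ] H) {ι : Type*} (b : HilbertBasis ι ℝ H) {C : ℝ}
    (hC : ∀ s : Finset ι, ∑ i ∈ s, ‖T (b i)‖ ^ 2 ≤ C) : IsCompactOperator T := by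
  have hsum : Summable fun i => ‖T (b i)‖ ^ 2 :=
    summable_of_sum_le (fun _ => by positivity) hC
  let R : ι → H →L[ℝ] H := fun i => (innerSL ℝ (b i)).smulRight (T (b i))
  have hbound : ∀ s : Finset ι, ‖∑ i ∈ s, R i‖ ≤ √(∑ i ∈ s, ‖T (b i)‖ ^ 2) := by
    intro s
    refine ContinuousLinearMap.opNorm_le_bound _ (Real.sqrt_nonneg _) fun x => ?_
    have hR : (∑ i ∈ s, R i) x = ∑ i ∈ s, inner ℝ (b i) x • T (b i) := by simp [R]
    rw [hR]
    calc ‖∑ i ∈ s, inner ℝ (b i) x • T (b i)‖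
        ≤ ∑ i ∈ s, ‖inner ℝ (b i) x‖ * ‖T (b i)‖ := by
          refine (norm_sum_le _ _).trans_eq (Finset.sum_congr rfl fun i _ => norm_smul _ _)
      _ ≤ √(∑ i ∈ s, ‖inner ℝ (b i) x‖ ^ 2) * √(∑ i ∈ s, ‖T (b i)‖ ^ 2) :=
          Real.sum_mul_le_sqrt_mul_sqrt _ _ _
      _ ≤ ‖x‖ * √(∑ i ∈ s, ‖T (b i)‖ ^ 2) := by
          gcongr
          exact Real.sqrt_le_iff.2 ⟨norm_nonneg _, b.orthonormal.sum_inner_products_le x⟩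
      _ = √(∑ i ∈ s, ‖T (b i)‖ ^ 2) * ‖x‖ := mul_comm _ _
  have hRs : Summable R := by
    rw [summable_iff_vanishing_norm] at hsum ⊢
    intro ε hε
    obtain ⟨s, hs⟩ := hsum (ε ^ 2) (by positivity)
    refine ⟨s, fun t ht => (hbound t).trans_lt ?_⟩
    rw [Real.sqrt_lt' hε]
    exact (le_abs_self _).trans_lt (hs t ht)
  have hT : ∑' i, R i = T := by
    ext x
    have h1 : HasSum (fun i => R i x) ((∑' i, R i) x) := hRs.hasSum.mapL (.apply ℝ H x)
    have h2 : HasSum (fun i => R i x) (T x) := by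
      simpa [R, b.repr_apply_apply] using (b.hasSum_repr x).mapL T
    exact h1.unique h2
  refine isCompactOperator_of_tendsto (F := fun s => ∑ i ∈ s, R i) (hT ▸ hRs.hasSum) ?_
  refine Eventually.of_forall fun s => ?_
  refine (compactOperator (RingHom.id ℝ) H H).sum_mem (f := R) fun i _ => ?_
  exact (isCompactOperator_of_locallyCompactSpace_dom (innerSL ℝ (b i))).clm_comp
    (ContinuousLinearMap.toSpanSingleton ℝ (T (b i)))

/-- On a finite measure space the integral operator on `L²` with a bounded symmetric kernel `k` is
compact and symmetric. Compactness is Bessel's inequality for the functions `k x ·`, integrated in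
`x`. -/
theorem exists_compact_symmetric_integralOperator {α : Type*} [MeasurableSpace α] (μ : Measure α)
    [IsFiniteMeasure μ] {k : α → α → ℝ} (hk : StronglyMeasurable (Function.uncurry k)) {C : ℝ}
    (hC : ∀ x y, |k x y| ≤ C) (hsymm : ∀ x y, k x y = k y x) :
    ∃ K : Lp ℝ 2 μ →L[ℝ] Lp ℝ 2 μ, (∀ f, K f =ᵐ[μ] fun x => ∫ t, k x t * f t ∂μ) ∧
      IsCompactOperator K ∧ (K : Lp ℝ 2 μ →ₗ[ℝ] Lp ℝ 2 μ).IsSymmetric := by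
  have hkm : ∀ x, MemLp (k x) 2 μ := fun x =>
    MemLp.of_bound hk.of_uncurry_left.aestronglyMeasurable C (Eventually.of_forall (hC x))
  have hC0 : 0 ≤ |C| := abs_nonneg C
  set N : ℝ := measureUnivNNReal μ ^ (2 : ENNReal).toReal⁻¹ * |C| with hN
  have hN0 : 0 ≤ N := by positivity
  have hkN : ∀ x, ‖(hkm x).toLp‖ ≤ N := by
    intro x
    refine Lp.norm_le_of_ae_bound hC0 ?_
    filter_upwards [(hkm x).coeFn_toLp] with t ht
    rw [ht]
    exact (hC x t).trans (le_abs_self C)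
  have hinner : ∀ x (f : Lp ℝ 2 μ), ∫ t, k x t * f t ∂μ = inner ℝ (hkm x).toLp f := by
    intro x f
    rw [L2.inner_def]
    refine integral_congr_ae ?_
    filter_upwards [(hkm x).coeFn_toLp] with t ht
    simp [ht, mul_comm]
  have hle : ∀ x (f : Lp ℝ 2 μ), |∫ t, k x t * f t ∂μ| ≤ N * ‖f‖ := by
    intro x f
    rw [hinner]
    exact (abs_real_inner_le_norm _ _).trans (mul_le_mul_of_nonneg_right (hkN x) (norm_nonneg _))
  have hmeas : ∀ f : Lp ℝ 2 μ, StronglyMeasurable fun x => ∫ t, k x t * f t ∂μ := by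
    intro f
    refine StronglyMeasurable.integral_prod_right (f := fun x t => k x t * f t) ?_
    exact hk.mul ((Lp.stronglyMeasurable f).comp_measurable measurable_snd)
  have hmem : ∀ f : Lp ℝ 2 μ, MemLp (fun x => ∫ t, k x t * f t ∂μ) 2 μ := fun f =>
    MemLp.of_bound (hmeas f).aestronglyMeasurable _ (Eventually.of_forall fun x => hle x f)
  let K₀ : Lp ℝ 2 μ →ₗ[ℝ] Lp ℝ 2 μ :=
    { toFun := fun f => (hmem f).toLp
      map_add' := by
        intro f g
        rw [← MemLp.toLp_add]
        refine MemLp.toLp_congr _ _ (Eventually.of_forall fun x => ?_)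
        simp only [hinner, Pi.add_apply, inner_add_right]
      map_smul' := by
        intro c f
        rw [RingHom.id_apply, ← MemLp.toLp_const_smul]
        refine MemLp.toLp_congr _ _ (Eventually.of_forall fun x => ?_)
        simp only [hinner, Pi.smul_apply, inner_smul_right, smul_eq_mul] }
  let K : Lp ℝ 2 μ →L[ℝ] Lp ℝ 2 μ :=
    K₀.mkContinuous (measureUnivNNReal μ ^ (2 : ENNReal).toReal⁻¹ * N) (by
      intro f
      rw [mul_assoc]
      refine Lp.norm_le_of_ae_bound (by positivity) ?_
      filter_upwards [(hmem f).coeFn_toLp] with t ht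
      rw [show (K₀ f : α → ℝ) t = ∫ s, k t s * f s ∂μ from ht]
      exact hle t f)
  have hK : ∀ f, K f =ᵐ[μ] fun x => ∫ t, k x t * f t ∂μ := fun f => (hmem f).coeFn_toLp
  refine ⟨K, hK, ?_, ?_⟩
  · obtain ⟨w, b, -⟩ := exists_hilbertBasis ℝ (Lp ℝ 2 μ)
    refine isCompactOperator_of_sum_sq_le K b (C := N ^ 2 * μ.real univ) fun s => ?_
    have h1 : ∀ f, ‖K f‖ ^ 2 = ∫ x, (inner ℝ (hkm x).toLp f) ^ 2 ∂μ := by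
      intro f
      rw [← real_inner_self_eq_norm_sq, L2.inner_def]
      refine integral_congr_ae ?_
      filter_upwards [hK f] with x hx
      simp [hx, hinner, sq]
    have h2 : ∀ f : Lp ℝ 2 μ, Integrable (fun x => (inner ℝ (hkm x).toLp f) ^ 2) μ := by
      intro f
      simp only [← hinner]
      exact (hmem f).integrable_sq
    simp only [h1]
    rw [← integral_finsetSum _ fun i _ => h2 (b i)]
    calc ∫ x, ∑ i ∈ s, (inner ℝ (hkm x).toLp (b i)) ^ 2 ∂μ ≤ ∫ _, N ^ 2 ∂μ := by
          refine integral_mono (integrable_finsetSum _ fun i _ => h2 (b i))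
            (integrable_const _) fun x => ?_
          have := b.orthonormal.sum_inner_products_le (hkm x).toLp (s := s)
          simp only [Real.norm_eq_abs, sq_abs, real_inner_comm] at this
          exact this.trans (pow_le_pow_left₀ (norm_nonneg _) (hkN x) 2)
      _ = N ^ 2 * μ.real univ := by simp [mul_comm]
  · intro f g
    have hint : Integrable (Function.uncurry fun x t => k x t * f t * g x) (μ.prod μ) := by
      have hf : Integrable f μ := (Lp.memLp f).integrable (by norm_num)
      have hg : Integrable g μ := (Lp.memLp g).integrable (by norm_num)
      have := (hg.mul_prod hf).bdd_mul (c := C) hk.aestronglyMeasurable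
        (Eventually.of_forall fun z => hC z.1 z.2)
      refine this.congr (Eventually.of_forall fun z => ?_)
      simp only [Function.uncurry]
      ring
    change inner ℝ (K f) g = inner ℝ f (K g)
    rw [L2.inner_def, L2.inner_def]
    calc ∫ x, inner ℝ (K f x) (g x) ∂μ = ∫ x, ∫ t, k x t * f t * g x ∂μ ∂μ := by
          refine integral_congr_ae ?_
          filter_upwards [hK f] with x hx
          rw [integral_mul_const, ← hx]
          simp [mul_comm]
      _ = ∫ t, ∫ x, k x t * f t * g x ∂μ ∂μ := integral_integral_swap hint
      _ = ∫ t, inner ℝ (f t) (K g t) ∂μ := by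
          refine integral_congr_ae ?_
          filter_upwards [hK g] with t ht
          simp only [ht, RCLike.inner_apply, conj_trivial]
          rw [← integral_mul_const]
          refine integral_congr_ae (Eventually.of_forall fun x => ?_)
          simp only [hsymm x t]
          ring

/-! ### Piecewise continuous functions -/

/-- The restriction of `f` to each of `[-π, 0)` and `(0, π]` extends to a continuous function on the
line. -/
def PiecewiseContinuous (f : ℝ → ℝ) : Prop :=
  ∃ fL fR : ℝ → ℝ, Continuous fL ∧ Continuous fR ∧ EqOn f fL (Ico (-Real.pi) 0) ∧
    EqOn f fR (Ioc 0 Real.pi)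

theorem neg_pi_lt_zero : -Real.pi < 0 := neg_lt_zero.2 Real.pi_pos

theorem neg_pi_mem_J : -Real.pi ∈ J := Or.inl (left_mem_Ico.2 neg_pi_lt_zero)

theorem pi_mem_J : Real.pi ∈ J := Or.inr (right_mem_Ioc.2 Real.pi_pos)

theorem Icc_neg_pi_pi_subset : Icc (-Real.pi) Real.pi ⊆ Ioo (-4 : ℝ) 4 := fun x hx =>
  ⟨by linarith [hx.1, Real.pi_lt_four], by linarith [hx.2, Real.pi_lt_four]⟩

theorem J_subset : J ⊆ Ioo (-4 : ℝ) 4 := by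
  rintro x (hx | hx)
  · exact Icc_neg_pi_pi_subset ⟨hx.1, hx.2.le.trans Real.pi_pos.le⟩
  · exact Icc_neg_pi_pi_subset ⟨neg_pi_lt_zero.le.trans hx.1.le, hx.2⟩

theorem exists_continuous_eqOn_Ico {a b l : ℝ} (hab : a < b) {f : ℝ → ℝ}
    (hf : ContinuousOn f (Ico a b)) (hl : Tendsto f (𝓝[<] b) (𝓝 l)) :
    ∃ g, Continuous g ∧ EqOn f g (Ico a b) ∧ g b = l := by
  have hc : ContinuousOn (Function.update f b l) (Icc a b) := by
    rw [continuousOn_update_iff]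
    refine ⟨?_, fun _ => ?_⟩
    · rwa [Icc_sdiff_right]
    · rw [Icc_sdiff_right]
      exact hl.mono_left (nhdsWithin_mono _ fun x hx => hx.2)
  refine ⟨IccExtend hab.le ((Icc a b).domRestrict (Function.update f b l)),
    hc.domRestrict.Icc_extend', fun x hx => ?_, ?_⟩
  · rw [IccExtend_of_mem _ _ (Ico_subset_Icc_self hx)]
    simp [Function.update_of_ne hx.2.ne]
  · rw [IccExtend_of_mem _ _ (right_mem_Icc.2 hab.le)]
    simp

theorem exists_continuous_eqOn_Ioc {a b l : ℝ} (hab : a < b) {f : ℝ → ℝ}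
    (hf : ContinuousOn f (Ioc a b)) (hl : Tendsto f (𝓝[>] a) (𝓝 l)) :
    ∃ g, Continuous g ∧ EqOn f g (Ioc a b) ∧ g a = l := by
  have hc : ContinuousOn (Function.update f a l) (Icc a b) := by
    rw [continuousOn_update_iff]
    refine ⟨?_, fun _ => ?_⟩
    · rwa [Icc_sdiff_left]
    · rw [Icc_sdiff_left]
      exact hl.mono_left (nhdsWithin_mono _ fun x hx => hx.1)
  refine ⟨IccExtend hab.le ((Icc a b).domRestrict (Function.update f a l)),
    hc.domRestrict.Icc_extend', fun x hx => ?_, ?_⟩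
  · rw [IccExtend_of_mem _ _ (Ioc_subset_Icc_self hx)]
    simp [Function.update_of_ne hx.1.ne']
  · rw [IccExtend_of_mem _ _ (left_mem_Icc.2 hab.le)]
    simp

theorem PiecewiseContinuous.of_continuousOn {f : ℝ → ℝ} (hf : ContinuousOn f J) {l r : ℝ}
    (hl : Tendsto f (𝓝[<] 0) (𝓝 l)) (hr : Tendsto f (𝓝[>] 0) (𝓝 r)) : PiecewiseContinuous f := by
  obtain ⟨fL, hL, hL', -⟩ :=
    exists_continuous_eqOn_Ico neg_pi_lt_zero (hf.mono subset_union_left) hl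
  obtain ⟨fR, hR, hR', -⟩ :=
    exists_continuous_eqOn_Ioc Real.pi_pos (hf.mono subset_union_right) hr
  exact ⟨fL, fR, hL, hR, hL', hR'⟩

theorem PiecewiseContinuous.of_continuous {f : ℝ → ℝ} (hf : Continuous f) :
    PiecewiseContinuous f :=
  ⟨f, f, hf, hf, fun _ _ => rfl, fun _ _ => rfl⟩

namespace PiecewiseContinuous

variable {f g : ℝ → ℝ}

theorem comp₂ (hf : PiecewiseContinuous f) (hg : PiecewiseContinuous g) {F : ℝ → ℝ → ℝ}
    (hF : Continuous (Function.uncurry F)) : PiecewiseContinuous fun x => F (f x) (g x) := by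
  obtain ⟨fL, fR, hL, hR, hL', hR'⟩ := hf
  obtain ⟨gL, gR, kL, kR, kL', kR'⟩ := hg
  refine ⟨fun x => F (fL x) (gL x), fun x => F (fR x) (gR x), hF.comp (hL.prodMk kL),
    hF.comp (hR.prodMk kR), fun x hx => ?_, fun x hx => ?_⟩
  · simp only [hL' hx, kL' hx]
  · simp only [hR' hx, kR' hx]

theorem mul (hf : PiecewiseContinuous f) (hg : PiecewiseContinuous g) :
    PiecewiseContinuous fun x => f x * g x :=
  hf.comp₂ hg (F := fun a b => a * b) (by fun_prop)

theorem linComb (hf : PiecewiseContinuous f) (hg : PiecewiseContinuous g) (a b : ℝ) :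
    PiecewiseContinuous fun x => a * f x + b * g x :=
  hf.comp₂ hg (F := fun s t => a * s + b * t) (by fun_prop)

theorem const_mul (hf : PiecewiseContinuous f) (c : ℝ) : PiecewiseContinuous fun x => c * f x :=
  hf.comp₂ hf (F := fun s _ => c * s) (by fun_prop)

theorem congr (hf : PiecewiseContinuous f) (h : EqOn g f J) : PiecewiseContinuous g := by
  obtain ⟨fL, fR, hL, hR, hL', hR'⟩ := hf
  exact ⟨fL, fR, hL, hR, fun x hx => (h (Or.inl hx)).trans (hL' hx),
    fun x hx => (h (Or.inr hx)).trans (hR' hx)⟩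

theorem intervalIntegrable_left (hf : PiecewiseContinuous f) :
    IntervalIntegrable f volume (-Real.pi) 0 := by
  obtain ⟨fL, fR, hL, hR, hL', hR'⟩ := hf
  rw [intervalIntegrable_iff_integrableOn_Ico_of_le neg_pi_lt_zero.le]
  exact (hL.integrableOn_Icc.mono_set Ico_subset_Icc_self).congr_fun hL'.symm measurableSet_Ico

theorem intervalIntegrable_right (hf : PiecewiseContinuous f) :
    IntervalIntegrable f volume 0 Real.pi := by
  obtain ⟨fL, fR, hL, hR, hL', hR'⟩ := hf
  rw [intervalIntegrable_iff_integrableOn_Ioc_of_le Real.pi_pos.le]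
  exact (hR.integrableOn_Icc.mono_set Ioc_subset_Icc_self).congr_fun hR'.symm measurableSet_Ioc

end PiecewiseContinuous

/-- The interval integral sees `[-π, 0)`, although the interval of integration is `(-π, 0]`. -/
theorem integral_left_eq (f : ℝ → ℝ) :
    ∫ x in (-Real.pi)..0, f x = ∫ x in Ico (-Real.pi) 0, f x := by
  rw [intervalIntegral.integral_of_le neg_pi_lt_zero.le, integral_Ico_eq_integral_Ioo,
    integral_Ioc_eq_integral_Ioo]

theorem integral_right_eq (f : ℝ → ℝ) :
    ∫ x in (0 : ℝ)..Real.pi, f x = ∫ x in Ioc 0 Real.pi, f x :=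
  intervalIntegral.integral_of_le Real.pi_pos.le

theorem integral_left_congr {f g : ℝ → ℝ} (h : EqOn f g J) :
    ∫ x in (-Real.pi)..0, f x = ∫ x in (-Real.pi)..0, g x := by
  rw [integral_left_eq, integral_left_eq]
  exact setIntegral_congr_fun measurableSet_Ico fun x hx => h (Or.inl hx)

theorem integral_right_congr {f g : ℝ → ℝ} (h : EqOn f g J) :
    ∫ x in (0 : ℝ)..Real.pi, f x = ∫ x in (0 : ℝ)..Real.pi, g x := by
  rw [integral_right_eq, integral_right_eq]
  exact setIntegral_congr_fun measurableSet_Ioc fun x hx => h (Or.inr hx)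

/-! ### The boundary value transmission problem with a right-hand side -/

/-- A function with derivative zero on a convex set equals its limit along any filter living on that
set. -/
theorem eq_of_hasDerivWithinAt_zero {s : Set ℝ} (hs : Convex ℝ s) {w : ℝ → ℝ}
    (h : ∀ x ∈ s, HasDerivWithinAt w 0 s x) {l : Filter ℝ} [l.NeBot] (hl : s ∈ l) {c : ℝ}
    (hc : Tendsto w l (𝓝 c)) {x : ℝ} (hx : x ∈ s) : w x = c := by
  refine tendsto_nhds_unique (tendsto_const_nhds.congr' ?_) hc
  filter_upwards [hl] with y hy
  have := hs.norm_image_sub_le_of_norm_hasDerivWithin_le (C := 0) h (by simp) hy hx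
  rw [zero_mul, norm_le_zero_iff, sub_eq_zero] at this
  exact this

theorem exists_cramer {a b c d : ℝ} (h : a * d - b * c ≠ 0) (s t : ℝ) :
    ∃ x y, a * x + b * y = s ∧ c * x + d * y = t := by
  refine ⟨(d * s - b * t) / (a * d - b * c), (a * t - c * s) / (a * d - b * c), ?_, ?_⟩
  · rw [mul_div_assoc', mul_div_assoc', ← add_div, div_eq_iff h]
    ring
  · rw [mul_div_assoc', mul_div_assoc', ← add_div, div_eq_iff h]
    ring

theorem Ico_mem_nhdsLT_zero : Ico (-Real.pi) 0 ∈ 𝓝[<] (0 : ℝ) :=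
  Ico_mem_nhdsLT neg_pi_lt_zero

theorem Ioc_mem_nhdsGT_zero : Ioc 0 Real.pi ∈ 𝓝[>] (0 : ℝ) :=
  Ioc_mem_nhdsGT Real.pi_pos

namespace Problem

variable {P : Problem}

theorem p_of_neg {x : ℝ} (hx : x < 0) : P.p x = P.p₁ := if_pos hx

theorem p_of_pos {x : ℝ} (hx : 0 < x) : P.p x = P.p₂ := if_neg hx.le.not_gt

theorem p_pos (x : ℝ) : 0 < P.p x := by
  unfold p
  split_ifs
  exacts [P.p₁_pos, P.p₂_pos]

theorem Δ₁₂_eq : P.Δ₁₂ = P.bp 0 0 * P.bp 1 1 - P.bp 0 1 * P.bp 1 0 := by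
  simp [Δ₁₂, T, Matrix.det_fin_two]

theorem Δ₃₄_eq : P.Δ₃₄ = P.bm 0 0 * P.bm 1 1 - P.bm 0 1 * P.bm 1 0 := by
  simp [Δ₃₄, T, Matrix.det_fin_two]

/-- The transmission conditions for the one-sided limits `y(0-), y'(0-), y(0+), y'(0+)`. -/
def Transmits (P : Problem) (yl yl' yr yr' : ℝ) : Prop :=
  ∀ i : Fin 2, P.bm i 1 * yl' + P.bm i 0 * yl + P.bp i 1 * yr' + P.bp i 0 * yr = 0

theorem exists_transmits_right (h : P.Δ₁₂ ≠ 0) (yl yl' : ℝ) :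
    ∃ yr yr', P.Transmits yl yl' yr yr' := by
  rw [Δ₁₂_eq] at h
  obtain ⟨yr, yr', h0, h1⟩ := exists_cramer h (-(P.bm 0 1 * yl' + P.bm 0 0 * yl))
    (-(P.bm 1 1 * yl' + P.bm 1 0 * yl))
  refine ⟨yr, yr', Fin.forall_fin_two.2 ⟨?_, ?_⟩⟩
  · linear_combination h0
  · linear_combination h1

theorem exists_transmits_left (h : P.Δ₃₄ ≠ 0) (yr yr' : ℝ) :
    ∃ yl yl', P.Transmits yl yl' yr yr' := by
  rw [Δ₃₄_eq] at h
  obtain ⟨yl, yl', h0, h1⟩ := exists_cramer h (-(P.bp 0 1 * yr' + P.bp 0 0 * yr))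
    (-(P.bp 1 1 * yr' + P.bp 1 0 * yr))
  refine ⟨yl, yl', Fin.forall_fin_two.2 ⟨?_, ?_⟩⟩
  · linear_combination h0
  · linear_combination h1

theorem Transmits.right_eq_zero (h : P.Δ₁₂ ≠ 0) {yr yr' : ℝ} (ht : P.Transmits 0 0 yr yr') :
    yr = 0 ∧ yr' = 0 := by
  rw [Δ₁₂_eq] at h
  have h0 := ht 0
  have h1 := ht 1
  constructor
  · refine (mul_eq_zero.1 (?_ : _ * yr = 0)).resolve_left h
    linear_combination P.bp 1 1 * h0 - P.bp 0 1 * h1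
  · refine (mul_eq_zero.1 (?_ : _ * yr' = 0)).resolve_left h
    linear_combination P.bp 0 0 * h1 - P.bp 1 0 * h0

/-- The transmission conditions carry `Δ₃₄` times the Wronskian at `0-` into `Δ₁₂` times the
Wronskian at `0+`. This is why the modified inner product makes the problem symmetric. -/
theorem Transmits.wronskian {yl yl' yr yr' zl zl' zr zr' : ℝ} (hy : P.Transmits yl yl' yr yr')
    (hz : P.Transmits zl zl' zr zr') :
    P.Δ₃₄ * (yl * zl' - yl' * zl) = P.Δ₁₂ * (yr * zr' - yr' * zr) := by
  rw [Δ₁₂_eq, Δ₃₄_eq]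
  have y0 := hy 0
  have y1 := hy 1
  have z0 := hz 0
  have z1 := hz 1
  linear_combination (P.bm 1 1 * zl' + P.bm 1 0 * zl) * y0
    - (P.bp 0 1 * yr' + P.bp 0 0 * yr) * z1
    - (P.bm 0 1 * zl' + P.bm 0 0 * zl) * y1 + (P.bp 1 1 * yr' + P.bp 1 0 * yr) * z0

/-- The pair `(y, y₁)`, where `y₁ = y'`, solves `-p y'' + q y = lam y + f` on `J` and satisfies the
transmission conditions; nothing is required at `±π`. -/
structure Forced (P : Problem) (lam : ℝ) (f y y₁ : ℝ → ℝ) (yl yl' yr yr' : ℝ) : Prop where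
  deriv_one : ∀ x ∈ J, HasDerivWithinAt y (y₁ x) J x
  deriv_two : ∀ x ∈ J, HasDerivWithinAt y₁ (((P.q x - lam) * y x - f x) / P.p x) J x
  tendsto_left : Tendsto y (𝓝[<] 0) (𝓝 yl)
  tendsto_left' : Tendsto y₁ (𝓝[<] 0) (𝓝 yl')
  tendsto_right : Tendsto y (𝓝[>] 0) (𝓝 yr)
  tendsto_right' : Tendsto y₁ (𝓝[>] 0) (𝓝 yr')
  transmits : P.Transmits yl yl' yr yr'

/-- The boundary condition at `-π`. -/
def LeftBC (P : Problem) (y y₁ : ℝ → ℝ) : Prop :=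
  Real.cos P.α * y (-Real.pi) + Real.sin P.α * y₁ (-Real.pi) = 0

/-- The boundary condition at `π`. -/
def RightBC (P : Problem) (y y₁ : ℝ → ℝ) : Prop :=
  Real.cos P.β * y Real.pi + Real.sin P.β * y₁ Real.pi = 0

theorem LeftBC.wronskian {y y₁ z z₁ : ℝ → ℝ} (hy : P.LeftBC y y₁) (hz : P.LeftBC z z₁) :
    y (-Real.pi) * z₁ (-Real.pi) - y₁ (-Real.pi) * z (-Real.pi) = 0 := by
  unfold LeftBC at hy hz
  linear_combination (Real.cos P.α * z₁ (-Real.pi) - Real.sin P.α * z (-Real.pi)) * hy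
    - (Real.cos P.α * y₁ (-Real.pi) - Real.sin P.α * y (-Real.pi)) * hz
    - (y (-Real.pi) * z₁ (-Real.pi) - y₁ (-Real.pi) * z (-Real.pi)) *
      Real.sin_sq_add_cos_sq P.α

theorem RightBC.wronskian {y y₁ z z₁ : ℝ → ℝ} (hy : P.RightBC y y₁) (hz : P.RightBC z z₁) :
    y Real.pi * z₁ Real.pi - y₁ Real.pi * z Real.pi = 0 := by
  unfold RightBC at hy hz
  linear_combination (Real.cos P.β * z₁ Real.pi - Real.sin P.β * z Real.pi) * hy
    - (Real.cos P.β * y₁ Real.pi - Real.sin P.β * y Real.pi) * hz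
    - (y Real.pi * z₁ Real.pi - y₁ Real.pi * z Real.pi) * Real.sin_sq_add_cos_sq P.β

namespace Forced

variable {lam : ℝ} {f y y₁ g z z₁ : ℝ → ℝ} {yl yl' yr yr' zl zl' zr zr' : ℝ}

theorem continuousOn (h : P.Forced lam f y y₁ yl yl' yr yr') : ContinuousOn y J := fun x hx =>
  (h.deriv_one x hx).continuousWithinAt

theorem piecewiseContinuous (h : P.Forced lam f y y₁ yl yl' yr yr') : PiecewiseContinuous y :=
  .of_continuousOn h.continuousOn h.tendsto_left h.tendsto_right

theorem congr_right (h : P.Forced lam f y y₁ yl yl' yr yr') (hfg : EqOn f g J) :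
    P.Forced lam g y y₁ yl yl' yr yr' :=
  { h with deriv_two := fun x hx => hfg hx ▸ h.deriv_two x hx }

/-- The parameter can be moved into the right-hand side. -/
theorem change_parameter (h : P.Forced lam f y y₁ yl yl' yr yr') (mu : ℝ) :
    P.Forced mu (fun x => (lam - mu) * y x + f x) y y₁ yl yl' yr yr' :=
  { h with
    deriv_two := fun x hx => (h.deriv_two x hx).congr_deriv (by ring) }

theorem linComb (h : P.Forced lam f y y₁ yl yl' yr yr') (k : P.Forced lam g z z₁ zl zl' zr zr')
    (a b : ℝ) :
    P.Forced lam (fun x => a * f x + b * g x) (fun x => a * y x + b * z x)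
      (fun x => a * y₁ x + b * z₁ x) (a * yl + b * zl) (a * yl' + b * zl') (a * yr + b * zr)
      (a * yr' + b * zr') where
  deriv_one x hx := ((h.deriv_one x hx).const_mul a).add ((k.deriv_one x hx).const_mul b)
  deriv_two x hx := (((h.deriv_two x hx).const_mul a).add
    ((k.deriv_two x hx).const_mul b)).congr_deriv (by ring)
  tendsto_left := (h.tendsto_left.const_mul a).add (k.tendsto_left.const_mul b)
  tendsto_left' := (h.tendsto_left'.const_mul a).add (k.tendsto_left'.const_mul b)
  tendsto_right := (h.tendsto_right.const_mul a).add (k.tendsto_right.const_mul b)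
  tendsto_right' := (h.tendsto_right'.const_mul a).add (k.tendsto_right'.const_mul b)
  transmits i := by linear_combination a * h.transmits i + b * k.transmits i

theorem hasDerivWithinAt_wronskian (h : P.Forced lam f y y₁ yl yl' yr yr')
    (k : P.Forced lam g z z₁ zl zl' zr zr') {x : ℝ} (hx : x ∈ J) :
    HasDerivWithinAt (fun x => y x * z₁ x - y₁ x * z x) ((f x * z x - y x * g x) / P.p x) J x := by
  refine (((h.deriv_one x hx).mul (k.deriv_two x hx)).sub
    ((h.deriv_two x hx).mul (k.deriv_one x hx))).congr_deriv ?_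
  ring

theorem tendsto_wronskian_left (h : P.Forced lam f y y₁ yl yl' yr yr')
    (k : P.Forced lam g z z₁ zl zl' zr zr') :
    Tendsto (fun x => y x * z₁ x - y₁ x * z x) (𝓝[<] 0) (𝓝 (yl * zl' - yl' * zl)) :=
  (h.tendsto_left.mul k.tendsto_left').sub (h.tendsto_left'.mul k.tendsto_left)

theorem tendsto_wronskian_right (h : P.Forced lam f y y₁ yl yl' yr yr')
    (k : P.Forced lam g z z₁ zl zl' zr zr') :
    Tendsto (fun x => y x * z₁ x - y₁ x * z x) (𝓝[>] 0) (𝓝 (yr * zr' - yr' * zr)) :=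
  (h.tendsto_right.mul k.tendsto_right').sub (h.tendsto_right'.mul k.tendsto_right)

/-- **Lagrange's identity**, integrated over both intervals. -/
theorem inn_eq (h : P.Forced lam f y y₁ yl yl' yr yr') (k : P.Forced lam g z z₁ zl zl' zr zr')
    (hf : PiecewiseContinuous f) (hg : PiecewiseContinuous g) (hl : P.LeftBC y y₁)
    (hl' : P.LeftBC z z₁) (hr : P.RightBC y y₁) (hr' : P.RightBC z z₁) :
    P.inn f z = P.inn y g := by
  have hy := h.piecewiseContinuous
  have hz := k.piecewiseContinuous
  have hfz := hf.mul hz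
  have hyg := hy.mul hg
  have hW := fun x hx => h.hasDerivWithinAt_wronskian k (x := x) hx
  set W : ℝ → ℝ := fun x => y x * z₁ x - y₁ x * z x with hWdef
  have e1 : ∫ x in (-Real.pi)..0, (f x * z x - y x * g x) / P.p₁ =
      (yl * zl' - yl' * zl) - W (-Real.pi) := by
    refine intervalIntegral.integral_eq_sub_of_hasDerivAt_of_tendsto (f := W) neg_pi_lt_zero
      (fun x hx => ?_) ?_ ?_ (h.tendsto_wronskian_left k)
    · rw [← P.p_of_neg hx.2]
      exact (hW x (Or.inl (Ioo_subset_Ico_self hx))).hasDerivAt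
        (mem_of_superset (Ioo_mem_nhds hx.1 hx.2) fun t ht => Or.inl (Ioo_subset_Ico_self ht))
    · exact (hfz.intervalIntegrable_left.sub hyg.intervalIntegrable_left).div_const _
    · exact (hW _ neg_pi_mem_J).continuousWithinAt.mono_left (nhdsWithin_le_iff.2
        (mem_of_superset (Ioo_mem_nhdsGT neg_pi_lt_zero) fun t ht =>
          Or.inl (Ioo_subset_Ico_self ht)))
  have e2 : ∫ x in (0 : ℝ)..Real.pi, (f x * z x - y x * g x) / P.p₂ =
      W Real.pi - (yr * zr' - yr' * zr) := by
    refine intervalIntegral.integral_eq_sub_of_hasDerivAt_of_tendsto (f := W) Real.pi_pos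
      (fun x hx => ?_) ?_ (h.tendsto_wronskian_right k) ?_
    · rw [← P.p_of_pos hx.1]
      exact (hW x (Or.inr (Ioo_subset_Ioc_self hx))).hasDerivAt
        (mem_of_superset (Ioo_mem_nhds hx.1 hx.2) fun t ht => Or.inr (Ioo_subset_Ioc_self ht))
    · exact (hfz.intervalIntegrable_right.sub hyg.intervalIntegrable_right).div_const _
    · exact (hW _ pi_mem_J).continuousWithinAt.mono_left (nhdsWithin_le_iff.2
        (mem_of_superset (Ioo_mem_nhdsLT Real.pi_pos) fun t ht =>
          Or.inr (Ioo_subset_Ioc_self ht)))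
  rw [intervalIntegral.integral_div, intervalIntegral.integral_sub
    hfz.intervalIntegrable_left hyg.intervalIntegrable_left] at e1
  rw [intervalIntegral.integral_div, intervalIntegral.integral_sub
    hfz.intervalIntegrable_right hyg.intervalIntegrable_right] at e2
  have w1 : W (-Real.pi) = 0 := hl.wronskian hl'
  have w2 : W Real.pi = 0 := hr.wronskian hr'
  unfold inn
  linear_combination P.Δ₃₄ * e1 + P.Δ₁₂ * e2 + h.transmits.wronskian k.transmits
    - P.Δ₃₄ * w1 + P.Δ₁₂ * w2

theorem wronskian_left (h : P.Forced lam 0 y y₁ yl yl' yr yr')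
    (k : P.Forced lam 0 z z₁ zl zl' zr zr') {x : ℝ} (hx : x ∈ Ico (-Real.pi) 0) :
    y x * z₁ x - y₁ x * z x = yl * zl' - yl' * zl := by
  refine eq_of_hasDerivWithinAt_zero (convex_Ico (-Real.pi) 0) (fun t ht => ?_)
    Ico_mem_nhdsLT_zero (h.tendsto_wronskian_left k) hx
  simpa using (h.hasDerivWithinAt_wronskian k (Or.inl ht)).mono subset_union_left

theorem wronskian_right (h : P.Forced lam 0 y y₁ yl yl' yr yr')
    (k : P.Forced lam 0 z z₁ zl zl' zr zr') {x : ℝ} (hx : x ∈ Ioc 0 Real.pi) :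
    y x * z₁ x - y₁ x * z x = yr * zr' - yr' * zr := by
  refine eq_of_hasDerivWithinAt_zero (convex_Ioc 0 Real.pi) (fun t ht => ?_)
    Ioc_mem_nhdsGT_zero (h.tendsto_wronskian_right k) hx
  simpa using (h.hasDerivWithinAt_wronskian k (Or.inr ht)).mono subset_union_right

end Forced

end Problem

/-! ### Solutions with prescribed Cauchy data -/

/-- The function equal to `u` on the negative half line and to `v` elsewhere. -/
noncomputable def glue (u v : ℝ → ℝ) (x : ℝ) : ℝ := if x < 0 then u x else v x

theorem glue_of_neg {u v : ℝ → ℝ} {x : ℝ} (hx : x < 0) : glue u v x = u x := if_pos hx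

theorem glue_of_pos {u v : ℝ → ℝ} {x : ℝ} (hx : 0 < x) : glue u v x = v x := if_neg hx.le.not_gt

theorem glue_hasDerivAt_of_neg {u v : ℝ → ℝ} {x d : ℝ} (hx : x < 0) (h : HasDerivAt u d x) :
    HasDerivAt (glue u v) d x :=
  h.congr_of_eventuallyEq <| by
    filter_upwards [Iio_mem_nhds hx] with t ht using glue_of_neg ht

theorem glue_hasDerivAt_of_pos {u v : ℝ → ℝ} {x d : ℝ} (hx : 0 < x) (h : HasDerivAt v d x) :
    HasDerivAt (glue u v) d x :=
  h.congr_of_eventuallyEq <| by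
    filter_upwards [Ioi_mem_nhds hx] with t ht using glue_of_pos ht

theorem glue_tendsto_left {u v : ℝ → ℝ} (h : ContinuousAt u 0) :
    Tendsto (glue u v) (𝓝[<] 0) (𝓝 (u 0)) := by
  refine (h.tendsto.mono_left nhdsWithin_le_nhds).congr' ?_
  filter_upwards [self_mem_nhdsWithin] with t ht using (glue_of_neg ht).symm

theorem glue_tendsto_right {u v : ℝ → ℝ} (h : ContinuousAt v 0) :
    Tendsto (glue u v) (𝓝[>] 0) (𝓝 (v 0)) := by
  refine (h.tendsto.mono_left nhdsWithin_le_nhds).congr' ?_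
  filter_upwards [self_mem_nhdsWithin] with t ht using (glue_of_pos ht).symm

theorem zero_mem_Ioo : (0 : ℝ) ∈ Ioo (-4 : ℝ) 4 := by norm_num

namespace Problem

variable {P : Problem} {lam : ℝ}

theorem piecewiseContinuous_q (P : Problem) : PiecewiseContinuous P.q := by
  obtain ⟨l, hl⟩ := P.q_left
  obtain ⟨r, hr⟩ := P.q_right
  exact .of_continuousOn P.q_continuousOn hl hr

theorem forced_glue {qL qR : ℝ → ℝ} (hL : EqOn P.q qL (Ico (-Real.pi) 0))
    (hR : EqOn P.q qR (Ioc 0 Real.pi)) {u u₁ v v₁ : ℝ → ℝ}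
    (hu : SolvesODE (fun t => (qL t - lam) / P.p₁) u u₁)
    (hv : SolvesODE (fun t => (qR t - lam) / P.p₂) v v₁)
    (ht : P.Transmits (u 0) (u₁ 0) (v 0) (v₁ 0)) :
    P.Forced lam 0 (glue u v) (glue u₁ v₁) (u 0) (u₁ 0) (v 0) (v₁ 0) where
  deriv_one := by
    intro x hx
    have hx4 := J_subset hx
    rcases hx with hx | hx
    · rw [glue_of_neg hx.2]
      exact (glue_hasDerivAt_of_neg hx.2 (hu x hx4).1).hasDerivWithinAt
    · rw [glue_of_pos hx.1]
      exact (glue_hasDerivAt_of_pos hx.1 (hv x hx4).1).hasDerivWithinAt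
  deriv_two := by
    intro x hx
    have hx4 := J_subset hx
    rcases hx with hx | hx
    · rw [glue_of_neg hx.2, p_of_neg hx.2, hL hx]
      refine (glue_hasDerivAt_of_neg hx.2 (hu x hx4).2).hasDerivWithinAt.congr_deriv ?_
      simp only [Pi.zero_apply]
      ring
    · rw [glue_of_pos hx.1, p_of_pos hx.1, hR hx]
      refine (glue_hasDerivAt_of_pos hx.1 (hv x hx4).2).hasDerivWithinAt.congr_deriv ?_
      simp only [Pi.zero_apply]
      ring
  tendsto_left := glue_tendsto_left (hu 0 zero_mem_Ioo).1.continuousAt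
  tendsto_left' := glue_tendsto_left (hu 0 zero_mem_Ioo).2.continuousAt
  tendsto_right := glue_tendsto_right (hv 0 zero_mem_Ioo).1.continuousAt
  tendsto_right' := glue_tendsto_right (hv 0 zero_mem_Ioo).2.continuousAt
  transmits := ht

theorem exists_forced_of_left_data (h : P.Δ₁₂ ≠ 0) (lam c d : ℝ) :
    ∃ (y y₁ : ℝ → ℝ) (yl yl' yr yr' : ℝ), P.Forced lam 0 y y₁ yl yl' yr yr' ∧
      y (-Real.pi) = c ∧ y₁ (-Real.pi) = d := by
  obtain ⟨qL, qR, cL, cR, hL, hR⟩ := P.piecewiseContinuous_q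
  obtain ⟨u, u₁, hu, rfl, rfl⟩ := exists_solvesODE (Q := fun t => (qL t - lam) / P.p₁)
    ((cL.sub continuous_const).div_const _) (J_subset neg_pi_mem_J) c d
  obtain ⟨a, b, hab⟩ := P.exists_transmits_right h (u 0) (u₁ 0)
  obtain ⟨v, v₁, hv, rfl, rfl⟩ := exists_solvesODE (Q := fun t => (qR t - lam) / P.p₂)
    ((cR.sub continuous_const).div_const _) zero_mem_Ioo a b
  exact ⟨_, _, _, _, _, _, forced_glue hL hR hu hv hab, glue_of_neg neg_pi_lt_zero,
    glue_of_neg neg_pi_lt_zero⟩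

theorem exists_forced_of_right_data (h : P.Δ₃₄ ≠ 0) (lam c d : ℝ) :
    ∃ (y y₁ : ℝ → ℝ) (yl yl' yr yr' : ℝ), P.Forced lam 0 y y₁ yl yl' yr yr' ∧
      y Real.pi = c ∧ y₁ Real.pi = d := by
  obtain ⟨qL, qR, cL, cR, hL, hR⟩ := P.piecewiseContinuous_q
  obtain ⟨v, v₁, hv, rfl, rfl⟩ := exists_solvesODE (Q := fun t => (qR t - lam) / P.p₂)
    ((cR.sub continuous_const).div_const _) (J_subset pi_mem_J) c d
  obtain ⟨a, b, hab⟩ := P.exists_transmits_left h (v 0) (v₁ 0)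
  obtain ⟨u, u₁, hu, rfl, rfl⟩ := exists_solvesODE (Q := fun t => (qL t - lam) / P.p₁)
    ((cL.sub continuous_const).div_const _) zero_mem_Ioo a b
  exact ⟨_, _, _, _, _, _, forced_glue hL hR hu hv hab, glue_of_pos Real.pi_pos,
    glue_of_pos Real.pi_pos⟩

theorem hasDerivWithinAt_wronskian_of_solvesODE {s : Set ℝ} {y y₁ z z₁ Q : ℝ → ℝ} {x : ℝ}
    (hy : HasDerivWithinAt y (y₁ x) s x) (hy₁ : HasDerivWithinAt y₁ (Q x * y x) s x)
    (hx : x ∈ Ioo (-4 : ℝ) 4) (hz : SolvesODE Q z z₁) :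
    HasDerivWithinAt (fun x => y x * z₁ x - y₁ x * z x) 0 s x := by
  refine ((hy.mul (hz x hx).2.hasDerivWithinAt).sub
    (hy₁.mul (hz x hx).1.hasDerivWithinAt)).congr_deriv ?_
  ring

/-- A solution of the homogeneous equation with zero Cauchy data at `-π` vanishes: at any point its
Wronskian with a solution having data `(0, 1)` there is the value of the solution. -/
theorem Forced.eq_zero_of_left_data (h12 : P.Δ₁₂ ≠ 0) {y y₁ : ℝ → ℝ} {yl yl' yr yr' : ℝ}
    (h : P.Forced lam 0 y y₁ yl yl' yr yr') (h0 : y (-Real.pi) = 0) (h1 : y₁ (-Real.pi) = 0) :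
    ∀ x ∈ J, y x = 0 := by
  obtain ⟨qL, qR, cL, cR, hL, hR⟩ := P.piecewiseContinuous_q
  have wL : ∀ z z₁, SolvesODE (fun t => (qL t - lam) / P.p₁) z z₁ → ∀ x ∈ Ico (-Real.pi) 0,
      y x * z₁ x - y₁ x * z x = 0 := by
    intro z z₁ hz x hx
    refine eq_of_hasDerivWithinAt_zero (convex_Ico (-Real.pi) 0)
      (w := fun x => y x * z₁ x - y₁ x * z x) (l := pure (-Real.pi)) (fun t ht => ?_)
      (left_mem_Ico.2 neg_pi_lt_zero) ?_ hx
    · refine hasDerivWithinAt_wronskian_of_solvesODE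
        ((h.deriv_one t (Or.inl ht)).mono subset_union_left) ?_ (J_subset (Or.inl ht)) hz
      refine ((h.deriv_two t (Or.inl ht)).mono subset_union_left).congr_deriv ?_
      rw [p_of_neg ht.2, hL ht]
      simp only [Pi.zero_apply]
      ring
    · have := tendsto_pure_nhds (fun x => y x * z₁ x - y₁ x * z x) (-Real.pi)
      simpa [h0, h1] using this
  have yL : ∀ x ∈ Ico (-Real.pi) 0, y x = 0 ∧ y₁ x = 0 := by
    intro x hx
    obtain ⟨z, z₁, hz, e0, e1⟩ := exists_solvesODE (Q := fun t => (qL t - lam) / P.p₁)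
      ((cL.sub continuous_const).div_const _) (J_subset (Or.inl hx)) 0 1
    obtain ⟨v, v₁, hv, f0, f1⟩ := exists_solvesODE (Q := fun t => (qL t - lam) / P.p₁)
      ((cL.sub continuous_const).div_const _) (J_subset (Or.inl hx)) 1 0
    have hz' := wL z z₁ hz x hx
    have hv' := wL v v₁ hv x hx
    rw [e0, e1] at hz'
    rw [f0, f1] at hv'
    constructor <;> linarith
  have hyl : yl = 0 := by
    refine tendsto_nhds_unique h.tendsto_left (tendsto_const_nhds.congr' ?_)
    filter_upwards [Ico_mem_nhdsLT_zero] with t ht using (yL t ht).1.symm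
  have hyl' : yl' = 0 := by
    refine tendsto_nhds_unique h.tendsto_left' (tendsto_const_nhds.congr' ?_)
    filter_upwards [Ico_mem_nhdsLT_zero] with t ht using (yL t ht).2.symm
  have htr := h.transmits
  rw [hyl, hyl'] at htr
  obtain ⟨hyr, hyr'⟩ := htr.right_eq_zero h12
  rintro x (hx | hx)
  · exact (yL x hx).1
  · obtain ⟨z, z₁, hz, e0, e1⟩ := exists_solvesODE (Q := fun t => (qR t - lam) / P.p₂)
      ((cR.sub continuous_const).div_const _) (J_subset (Or.inr hx)) 0 1
    have := eq_of_hasDerivWithinAt_zero (convex_Ioc 0 Real.pi)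
      (w := fun x => y x * z₁ x - y₁ x * z x) (c := 0) (fun t ht => ?_)
      Ioc_mem_nhdsGT_zero ?_ hx
    · simpa [e0, e1] using this
    · refine hasDerivWithinAt_wronskian_of_solvesODE
        ((h.deriv_one t (Or.inr ht)).mono subset_union_right) ?_ (J_subset (Or.inr ht)) hz
      refine ((h.deriv_two t (Or.inr ht)).mono subset_union_right).congr_deriv ?_
      rw [p_of_pos ht.1, hR ht]
      simp only [Pi.zero_apply]
      ring
    · have c0 := (hz 0 zero_mem_Ioo).1.continuousAt.tendsto.mono_left
        (nhdsWithin_le_nhds (s := Ioi 0))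
      have c1 := (hz 0 zero_mem_Ioo).2.continuousAt.tendsto.mono_left
        (nhdsWithin_le_nhds (s := Ioi 0))
      simpa [hyr, hyr'] using (h.tendsto_right.mul c1).sub (h.tendsto_right'.mul c0)

/-! ### Eigenvalues and eigenfunctions -/

/-- `y` solves `-p y'' + q y = lam y + f` on `J` together with the boundary and the transmission
conditions. -/
def Solves (P : Problem) (lam : ℝ) (f y : ℝ → ℝ) : Prop :=
  ∃ (y₁ : ℝ → ℝ) (yl yl' yr yr' : ℝ), P.Forced lam f y y₁ yl yl' yr yr' ∧ P.LeftBC y y₁ ∧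
    P.RightBC y y₁

namespace Solves

variable {f g y z : ℝ → ℝ}

theorem piecewiseContinuous (h : P.Solves lam f y) : PiecewiseContinuous y := by
  obtain ⟨y₁, yl, yl', yr, yr', h, -⟩ := h
  exact h.piecewiseContinuous

theorem congr_right (h : P.Solves lam f y) (hfg : EqOn f g J) : P.Solves lam g y := by
  obtain ⟨y₁, yl, yl', yr, yr', h, hbc⟩ := h
  exact ⟨y₁, yl, yl', yr, yr', h.congr_right hfg, hbc⟩

theorem change_parameter (h : P.Solves lam f y) (mu : ℝ) :
    P.Solves mu (fun x => (lam - mu) * y x + f x) y := by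
  obtain ⟨y₁, yl, yl', yr, yr', h, hbc⟩ := h
  exact ⟨y₁, yl, yl', yr, yr', h.change_parameter mu, hbc⟩

theorem linComb (h : P.Solves lam f y) (k : P.Solves lam g z) (a b : ℝ) :
    P.Solves lam (fun x => a * f x + b * g x) (fun x => a * y x + b * z x) := by
  obtain ⟨y₁, yl, yl', yr, yr', h, hl, hr⟩ := h
  obtain ⟨z₁, zl, zl', zr, zr', k, kl, kr⟩ := k
  refine ⟨_, _, _, _, _, h.linComb k a b, ?_, ?_⟩
  · unfold LeftBC at *
    linear_combination a * hl + b * kl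
  · unfold RightBC at *
    linear_combination a * hr + b * kr

/-- The problem is symmetric with respect to the modified inner product. -/
theorem inn_eq (h : P.Solves lam f y) (k : P.Solves lam g z) (hf : PiecewiseContinuous f)
    (hg : PiecewiseContinuous g) : P.inn f z = P.inn y g := by
  obtain ⟨y₁, yl, yl', yr, yr', h, hl, hr⟩ := h
  obtain ⟨z₁, zl, zl', zr, zr', k, kl, kr⟩ := k
  exact h.inn_eq k hf hg hl kl hr kr

end Solves

theorem inn_congr {u v u' v' : ℝ → ℝ} (hu : EqOn u u' J) (hv : EqOn v v' J) :
    P.inn u v = P.inn u' v' := by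
  unfold inn
  rw [integral_left_congr (g := fun x => u' x * v' x) fun x hx => by simp only [hu hx, hv hx],
    integral_right_congr (g := fun x => u' x * v' x) fun x hx => by simp only [hu hx, hv hx]]

theorem inn_comm (u v : ℝ → ℝ) : P.inn u v = P.inn v u := by
  simp only [inn, mul_comm]

theorem inn_const_mul_left (c : ℝ) (u v : ℝ → ℝ) :
    P.inn (fun x => c * u x) v = c * P.inn u v := by
  simp only [inn, mul_assoc, intervalIntegral.integral_const_mul]
  ring

theorem inn_linComb_left {u v w : ℝ → ℝ} (hu : PiecewiseContinuous u) (hv : PiecewiseContinuous v)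
    (hw : PiecewiseContinuous w) (a b : ℝ) :
    P.inn (fun x => a * u x + b * v x) w = a * P.inn u w + b * P.inn v w := by
  have h1 := hu.mul hw
  have h2 := hv.mul hw
  simp only [inn, add_mul, mul_assoc]
  rw [intervalIntegral.integral_add (h1.intervalIntegrable_left.const_mul a)
    (h2.intervalIntegrable_left.const_mul b), intervalIntegral.integral_add
    (h1.intervalIntegrable_right.const_mul a) (h2.intervalIntegrable_right.const_mul b)]
  simp only [intervalIntegral.integral_const_mul]
  ring

theorem inn_self_nonneg (h12 : 0 < P.Δ₁₂) (h34 : 0 < P.Δ₃₄) (u : ℝ → ℝ) : 0 ≤ P.inn u u := by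
  have := P.p₁_pos
  have := P.p₂_pos
  refine add_nonneg (mul_nonneg (by positivity) ?_) (mul_nonneg (by positivity) ?_)
  · exact intervalIntegral.integral_nonneg neg_pi_lt_zero.le fun x _ => mul_self_nonneg _
  · exact intervalIntegral.integral_nonneg Real.pi_pos.le fun x _ => mul_self_nonneg _

theorem eq_zero_of_inn_self (h12 : 0 < P.Δ₁₂) (h34 : 0 < P.Δ₃₄) {u : ℝ → ℝ}
    (hu : PiecewiseContinuous u) (h : P.inn u u ≤ 0) : ∀ x ∈ J, u x = 0 := by
  have := P.p₁_pos
  have := P.p₂_pos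
  have w1 : 0 < P.Δ₃₄ / P.p₁ := by positivity
  have w2 : 0 < P.Δ₁₂ / P.p₂ := by positivity
  have i1 : 0 ≤ ∫ x in (-Real.pi)..0, u x * u x :=
    intervalIntegral.integral_nonneg neg_pi_lt_zero.le fun x _ => mul_self_nonneg _
  have i2 : 0 ≤ ∫ x in (0 : ℝ)..Real.pi, u x * u x :=
    intervalIntegral.integral_nonneg Real.pi_pos.le fun x _ => mul_self_nonneg _
  obtain ⟨uL, uR, cL, cR, hL, hR⟩ := hu
  rintro x (hx | hx) <;> by_contra hne
  · have : 0 < ∫ x in (-Real.pi)..0, u x * u x := by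
      have e : ∫ x in (-Real.pi)..0, u x * u x = ∫ x in (-Real.pi)..0, uL x * uL x := by
        rw [integral_left_eq, integral_left_eq]
        exact setIntegral_congr_fun measurableSet_Ico fun x hx => by simp only [hL hx]
      rw [e]
      refine intervalIntegral.integral_pos neg_pi_lt_zero (cL.mul cL).continuousOn
        (fun x _ => mul_self_nonneg _) ⟨x, Ico_subset_Icc_self hx, ?_⟩
      rw [← hL hx]
      exact mul_self_pos.2 hne
    unfold inn at h
    nlinarith [mul_pos w1 this, mul_nonneg w2.le i2]
  · have : 0 < ∫ x in (0 : ℝ)..Real.pi, u x * u x := by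
      have e : ∫ x in (0 : ℝ)..Real.pi, u x * u x = ∫ x in (0 : ℝ)..Real.pi, uR x * uR x := by
        rw [integral_right_eq, integral_right_eq]
        exact setIntegral_congr_fun measurableSet_Ioc fun x hx => by simp only [hR hx]
      rw [e]
      refine intervalIntegral.integral_pos Real.pi_pos (cR.mul cR).continuousOn
        (fun x _ => mul_self_nonneg _) ⟨x, Ioc_subset_Icc_self hx, ?_⟩
      rw [← hR hx]
      exact mul_self_pos.2 hne
    unfold inn at h
    nlinarith [mul_pos w2 this, mul_nonneg w1.le i1]

/-- Eigenfunctions for distinct eigenvalues are orthogonal. -/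
theorem inn_eq_zero_of_ne {mu : ℝ} {u v : ℝ → ℝ} (hu : P.Solves lam 0 u) (hv : P.Solves mu 0 v)
    (hne : lam ≠ mu) : P.inn u v = 0 := by
  have hu' := hu.change_parameter mu
  simp only [Pi.zero_apply, add_zero] at hu'
  have hz : PiecewiseContinuous (0 : ℝ → ℝ) := .of_continuous continuous_const
  have h := hu'.inn_eq hv (hu.piecewiseContinuous.const_mul _) hz
  rw [inn_const_mul_left] at h
  have h0 : P.inn u 0 = 0 := by simp [inn]
  rw [h0] at h
  exact (mul_eq_zero.1 h).resolve_left (sub_ne_zero.2 hne)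

/-- Eigenvalues are simple: the boundary condition leaves a line of Cauchy data at `-π`, and these
data determine the solution. -/
theorem Solves.exists_eq_const_mul (h12 : P.Δ₁₂ ≠ 0) {u v : ℝ → ℝ} (hu : P.Solves lam 0 u)
    (hv : P.Solves lam 0 v) (hne : ∃ x ∈ J, u x ≠ 0) : ∃ c : ℝ, ∀ x ∈ J, v x = c * u x := by
  obtain ⟨u₁, ul, ul', ur, ur', hu, hul, -⟩ := hu
  obtain ⟨v₁, vl, vl', vr, vr', hv, hvl, -⟩ := hv
  have hW := hul.wronskian hvl
  have hdata : u (-Real.pi) ≠ 0 ∨ u₁ (-Real.pi) ≠ 0 := by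
    by_contra! h
    obtain ⟨x, hx, hx'⟩ := hne
    exact hx' (hu.eq_zero_of_left_data h12 h.1 h.2 x hx)
  obtain ⟨c, h0, h1⟩ : ∃ c : ℝ, v (-Real.pi) = c * u (-Real.pi) ∧
      v₁ (-Real.pi) = c * u₁ (-Real.pi) := by
    rcases hdata with h | h
    · refine ⟨v (-Real.pi) / u (-Real.pi), by field_simp, ?_⟩
      field_simp
      linear_combination hW
    · refine ⟨v₁ (-Real.pi) / u₁ (-Real.pi), ?_, by field_simp⟩
      field_simp
      linear_combination -hW
  refine ⟨c, fun x hx => ?_⟩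
  have hd := (hv.linComb hu 1 (-c)).congr_right (g := 0) fun x _ => by simp
  have := hd.eq_zero_of_left_data h12 (by rw [h0]; ring) (by rw [h1]; ring) x hx
  linear_combination this

theorem isEigenfunction_iff {y : ℝ → ℝ} :
    P.IsEigenfunction lam y ↔ P.Solves lam 0 y ∧ ∃ x ∈ J, y x ≠ 0 := by
  refine and_congr_left fun _ => ⟨?_, ?_⟩
  · rintro ⟨y', y'', yl, yl', yr, yr', h⟩
    refine ⟨y', yl, yl', yr, yr', ⟨h.deriv_one, fun x hx => ?_, h.tendsto_left, h.tendsto_left',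
      h.tendsto_right, h.tendsto_right', h.transmission⟩, h.boundary_left, h.boundary_right⟩
    refine (h.deriv_two x hx).congr_deriv ?_
    have := h.equation x hx
    simp only [smul_eq_mul] at this
    rw [eq_div_iff (P.p_pos x).ne', Pi.zero_apply]
    linear_combination -this
  · rintro ⟨y₁, yl, yl', yr, yr', h, hl, hr⟩
    refine ⟨y₁, _, yl, yl', yr, yr', h.deriv_one, h.deriv_two, fun x _ => ?_, hl, hr,
      h.tendsto_left, h.tendsto_left', h.tendsto_right, h.tendsto_right', h.transmits⟩
    have := (P.p_pos x).ne'
    simp only [smul_eq_mul, Pi.zero_apply]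
    field_simp
    ring

/-- A real eigenfunction is also a complex one. -/
theorem ofReal_mem_eigenvalues {y : ℝ → ℝ} (h : P.Solves lam 0 y) (hne : ∃ x ∈ J, y x ≠ 0) :
    (lam : ℂ) ∈ P.eigenvalues := by
  obtain ⟨⟨y', y'', yl, yl', yr, yr', k⟩, x, hx, hx'⟩ := isEigenfunction_iff.2 ⟨h, hne⟩
  refine ⟨fun x => (y x : ℂ), ⟨fun x => y' x, fun x => y'' x, yl, yl', yr, yr', ?_⟩, x, hx,
    Complex.ofReal_ne_zero.2 hx'⟩
  have ht : ∀ {w : ℝ → ℝ} {l : Filter ℝ} {c : ℝ}, Tendsto w l (𝓝 c) →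
      Tendsto (fun x => (w x : ℂ)) l (𝓝 (c : ℂ)) := fun h =>
    (Complex.continuous_ofReal.tendsto _).comp h
  refine ⟨fun x hx => (k.deriv_one x hx).ofReal_comp, fun x hx => (k.deriv_two x hx).ofReal_comp,
    fun x hx => ?_, ?_, ?_, ht k.tendsto_left, ht k.tendsto_left', ht k.tendsto_right,
    ht k.tendsto_right', fun i => ?_⟩
  · have := k.equation x hx
    simp only [smul_eq_mul] at this
    simp only [Complex.real_smul]
    exact_mod_cast this
  · have := k.boundary_left
    simp only [smul_eq_mul] at this
    simp only [Complex.real_smul]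
    exact_mod_cast this
  · have := k.boundary_right
    simp only [smul_eq_mul] at this
    simp only [Complex.real_smul]
    exact_mod_cast this
  · have := k.transmission i
    simp only [smul_eq_mul] at this
    simp only [Complex.real_smul]
    exact_mod_cast this

/-- Applying a real linear functional such as the real or the imaginary part to a complex solution
gives a solution of a real problem, the term `mu y` becoming the right-hand side. -/
theorem IsSolutionWith.solves_clm {mu : ℂ} {y y' y'' : ℝ → ℂ} {yl yl' yr yr' : ℂ}
    (h : P.IsSolutionWith mu y y' y'' yl yl' yr yr') (L : ℂ →L[ℝ] ℝ) :
    P.Solves 0 (fun x => L (mu * y x)) (fun x => L (y x)) := by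
  have hs : ∀ (a : ℝ) (w : ℂ), L (a • w) = a * L w := fun a w => L.map_smul a w
  have ht : ∀ {w : ℝ → ℂ} {l : Filter ℝ} {c : ℂ}, Tendsto w l (𝓝 c) →
      Tendsto (fun x => L (w x)) l (𝓝 (L c)) := fun h => (L.continuous.tendsto _).comp h
  refine ⟨fun x => L (y' x), L yl, L yl', L yr, L yr',
    ⟨fun x hx => L.hasFDerivAt.comp_hasDerivWithinAt x (h.deriv_one x hx), fun x hx => ?_,
      ht h.tendsto_left, ht h.tendsto_left', ht h.tendsto_right, ht h.tendsto_right', fun i => ?_⟩,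
    ?_, ?_⟩
  · refine (L.hasFDerivAt.comp_hasDerivWithinAt x (h.deriv_two x hx)).congr_deriv ?_
    rw [eq_div_iff (P.p_pos x).ne', ← h.equation x hx]
    simp only [map_add, map_neg, hs]
    ring
  · have := congrArg L (h.transmission i)
    simpa only [map_add, hs, map_zero] using this
  · have := congrArg L h.boundary_left
    simpa only [map_add, hs, map_zero, LeftBC] using this
  · have := congrArg L h.boundary_right
    simpa only [map_add, hs, map_zero, RightBC] using this

/-- Eigenvalues are real and have real eigenfunctions. Symmetry, applied to the real and the
imaginary part of an eigenfunction, gives that the imaginary part of the eigenvalue times the squared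
norm of the eigenfunction is zero. -/
theorem exists_real_of_mem_eigenvalues (h12 : 0 < P.Δ₁₂) (h34 : 0 < P.Δ₃₄) {mu : ℂ}
    (hmu : mu ∈ P.eigenvalues) :
    ∃ (lam : ℝ) (y : ℝ → ℝ), mu = lam ∧ P.Solves lam 0 y ∧ ∃ x ∈ J, y x ≠ 0 := by
  obtain ⟨y, ⟨y', y'', yl, yl', yr, yr', h⟩, x₀, hx₀, hne⟩ := hmu
  have ha := h.solves_clm Complex.reCLM
  have hb := h.solves_clm Complex.imCLM
  simp only [Complex.reCLM_apply, Complex.imCLM_apply, Complex.mul_re, Complex.mul_im] at ha hb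
  have pa := ha.piecewiseContinuous
  have pb := hb.piecewiseContinuous
  set a : ℝ → ℝ := fun x => (y x).re with ha_def
  set b : ℝ → ℝ := fun x => (y x).im with hb_def
  replace ha : P.Solves 0 (fun x => mu.re * a x + (-mu.im) * b x) a :=
    ha.congr_right fun x _ => by simp only [ha_def, hb_def]; ring
  replace hb : P.Solves 0 (fun x => mu.re * b x + mu.im * a x) b :=
    hb.congr_right fun x _ => by simp only [ha_def, hb_def]
  have key := ha.inn_eq hb (pa.linComb pb _ _) (pb.linComb pa _ _)
  rw [P.inn_comm a, inn_linComb_left pa pb pb, inn_linComb_left pb pa pa, P.inn_comm b a] at key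
  have hne' : a x₀ ≠ 0 ∨ b x₀ ≠ 0 := by
    by_contra! hab
    exact hne (Complex.ext hab.1 hab.2)
  have him : mu.im = 0 := by
    by_contra hmu
    have hsum : P.inn a a + P.inn b b = 0 := by
      refine (mul_eq_zero.1 (?_ : mu.im * _ = 0)).resolve_left hmu
      linear_combination -key
    have h1 := P.inn_self_nonneg h12 h34 a
    have h2 := P.inn_self_nonneg h12 h34 b
    rcases hne' with h | h
    · exact h (eq_zero_of_inn_self h12 h34 pa (by linarith) x₀ hx₀)
    · exact h (eq_zero_of_inn_self h12 h34 pb (by linarith) x₀ hx₀)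
  refine ⟨mu.re, ?_⟩
  have hre : mu = mu.re := Complex.ext rfl (by simpa using him)
  rw [him] at ha hb
  rcases hne' with h | h
  · exact ⟨a, hre, (ha.change_parameter mu.re).congr_right fun x _ => by simp, x₀, hx₀, h⟩
  · exact ⟨b, hre, (hb.change_parameter mu.re).congr_right fun x _ => by simp, x₀, hx₀, h⟩

end Problem

/-! ### The modified Hilbert space -/

theorem measurableSet_J : MeasurableSet J := measurableSet_Ico.union measurableSet_Ioc

/-- A piecewise continuous function agrees on `J` with a bounded measurable function on the line. -/
theorem PiecewiseContinuous.exists_bounded {f : ℝ → ℝ} (hf : PiecewiseContinuous f) :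
    ∃ g : ℝ → ℝ, Measurable g ∧ (∃ C, ∀ x, |g x| ≤ C) ∧ EqOn f g J := by
  obtain ⟨fL, fR, cL, cR, hL, hR⟩ := hf
  obtain ⟨A, hA⟩ := isCompact_Icc.exists_bound_of_continuousOn (s := Icc (-Real.pi) 0)
    cL.continuousOn
  obtain ⟨B, hB⟩ := isCompact_Icc.exists_bound_of_continuousOn (s := Icc 0 Real.pi)
    cR.continuousOn
  refine ⟨fun x => (Ico (-Real.pi) 0).indicator fL x + (Ioc 0 Real.pi).indicator fR x,
    (cL.measurable.indicator measurableSet_Ico).add (cR.measurable.indicator measurableSet_Ioc),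
    ⟨|A| + |B|, fun x => (abs_add_le _ _).trans (add_le_add ?_ ?_)⟩, ?_⟩
  · by_cases hx : x ∈ Ico (-Real.pi) 0
    · rw [indicator_of_mem hx]
      exact (hA x (Ico_subset_Icc_self hx)).trans (le_abs_self A)
    · simp [indicator_of_notMem hx]
  · by_cases hx : x ∈ Ioc 0 Real.pi
    · rw [indicator_of_mem hx]
      exact (hB x (Ioc_subset_Icc_self hx)).trans (le_abs_self B)
    · simp [indicator_of_notMem hx]
  · rintro x (hx | hx)
    · have : x ∉ Ioc 0 Real.pi := fun h => absurd h.1 hx.2.not_gt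
      simp only [indicator_of_mem hx, indicator_of_notMem this, hL hx, add_zero]
    · have : x ∉ Ico (-Real.pi) 0 := fun h => absurd h.2 hx.1.not_gt
      simp only [indicator_of_mem hx, indicator_of_notMem this, hR hx, zero_add]

namespace Problem

variable {P : Problem}

theorem weight_le (P : Problem) :
    P.weight ≤ (ENNReal.ofReal (P.Δ₃₄ / P.p₁) + ENNReal.ofReal (P.Δ₁₂ / P.p₂)) •
      volume.restrict J := by
  rw [weight, add_smul]
  gcongr
  · exact subset_union_left
  · exact subset_union_right

theorem weight_absolutelyContinuous (P : Problem) : P.weight ≪ volume.restrict J :=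
  (Measure.absolutelyContinuous_of_le P.weight_le).trans (Measure.smul_absolutelyContinuous)

instance (P : Problem) : IsFiniteMeasure P.weight := by
  have : IsFiniteMeasure (volume.restrict J) := ⟨by
    rw [Measure.restrict_apply_univ]
    refine (measure_mono (J_subset.trans Ioo_subset_Icc_self)).trans_lt ?_
    simp⟩
  have := Measure.smul_finite (volume.restrict J)
    (c := ENNReal.ofReal (P.Δ₃₄ / P.p₁) + ENNReal.ofReal (P.Δ₁₂ / P.p₂)) (by finiteness)
  exact isFiniteMeasure_of_le _ P.weight_le

instance (P : Problem) : NullSingletonClass P.weight :=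
  ⟨fun x => P.weight_absolutelyContinuous (measure_singleton x)⟩

theorem ae_mem_J (P : Problem) : ∀ᵐ x ∂P.weight, x ∈ J :=
  P.weight_absolutelyContinuous.ae_le (ae_restrict_mem measurableSet_J)

theorem ae_eq_of_eqOn {f g : ℝ → ℝ} (h : EqOn f g J) : f =ᵐ[P.weight] g := by
  filter_upwards [P.ae_mem_J] with x hx using h hx

theorem memLp_weight {f : ℝ → ℝ} (hf : MemLp f 2 (volume.restrict J)) : MemLp f 2 P.weight :=
  hf.of_measure_le_smul (by finiteness) P.weight_le

theorem memLp_of_piecewiseContinuous {f : ℝ → ℝ} (hf : PiecewiseContinuous f) :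
    MemLp f 2 P.weight := by
  obtain ⟨g, hg, ⟨C, hC⟩, hfg⟩ := hf.exists_bounded
  exact (MemLp.of_bound hg.aestronglyMeasurable C (Eventually.of_forall hC)).ae_eq
    (ae_eq_of_eqOn hfg).symm

theorem weight_left_pos (h34 : 0 < P.Δ₃₄) : 0 < P.Δ₃₄ / P.p₁ := div_pos h34 P.p₁_pos

theorem weight_right_pos (h12 : 0 < P.Δ₁₂) : 0 < P.Δ₁₂ / P.p₂ := div_pos h12 P.p₂_pos

theorem ae_weight_iff (h12 : 0 < P.Δ₁₂) (h34 : 0 < P.Δ₃₄) {p : ℝ → Prop} :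
    (∀ᵐ x ∂P.weight, p x) ↔ (∀ᵐ x ∂volume.restrict (Ico (-Real.pi) 0), p x) ∧
      ∀ᵐ x ∂volume.restrict (Ioc 0 Real.pi), p x := by
  rw [weight, ae_add_measure_iff,
    Measure.ae_ennreal_smul_measure_iff (ENNReal.ofReal_pos.2 (weight_left_pos h34)).ne',
    Measure.ae_ennreal_smul_measure_iff (ENNReal.ofReal_pos.2 (weight_right_pos h12)).ne']

theorem integral_weight (h12 : 0 < P.Δ₁₂) (h34 : 0 < P.Δ₃₄) {h : ℝ → ℝ}
    (hh : Integrable h P.weight) :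
    ∫ x, h x ∂P.weight = P.Δ₃₄ / P.p₁ * (∫ x in Ico (-Real.pi) 0, h x) +
      P.Δ₁₂ / P.p₂ * ∫ x in Ioc 0 Real.pi, h x := by
  rw [weight, integrable_add_measure] at hh
  rw [weight, integral_add_measure hh.1 hh.2, integral_smul_measure, integral_smul_measure,
    ENNReal.toReal_ofReal (weight_left_pos h34).le,
    ENNReal.toReal_ofReal (weight_right_pos h12).le, smul_eq_mul, smul_eq_mul]

theorem inn_eq_integral (h12 : 0 < P.Δ₁₂) (h34 : 0 < P.Δ₃₄) {f g : ℝ → ℝ}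
    (hf : MemLp f 2 P.weight) (hg : MemLp g 2 P.weight) :
    P.inn f g = ∫ x, f x * g x ∂P.weight := by
  rw [integral_weight h12 h34 (h := fun x => f x * g x) (hf.integrable_mul hg), inn,
    integral_left_eq, integral_right_eq]

theorem inn_eq_inner (h12 : 0 < P.Δ₁₂) (h34 : 0 < P.Δ₃₄) {f g : ℝ → ℝ}
    (hf : MemLp f 2 P.weight) (hg : MemLp g 2 P.weight) :
    P.inn f g = inner ℝ hf.toLp hg.toLp := by
  rw [inn_eq_integral h12 h34 hf hg, L2.inner_def]
  refine integral_congr_ae ?_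
  filter_upwards [hf.coeFn_toLp, hg.coeFn_toLp] with x h1 h2
  simp [h1, h2, mul_comm]

/-! ### Indefinite integrals with respect to the weight -/

/-- The integral of `h` over `(-π, x]` with respect to the weight. -/
noncomputable def primitive (P : Problem) (h : ℝ → ℝ) (x : ℝ) : ℝ :=
  ∫ t in (-Real.pi)..x, h t ∂P.weight

theorem primitive_continuous {h : ℝ → ℝ} (hh : Integrable h P.weight) :
    Continuous (P.primitive h) :=
  intervalIntegral.continuous_primitive (fun _ _ => hh.intervalIntegrable) _

theorem primitive_neg_pi (h : ℝ → ℝ) : P.primitive h (-Real.pi) = 0 :=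
  intervalIntegral.integral_same (μ := P.weight)

theorem primitive_eq_setIntegral {x : ℝ} (hx : x ∈ J) (h : ℝ → ℝ) :
    P.primitive h x = ∫ t in Iio x, h t ∂P.weight := by
  have hx' : -Real.pi ≤ x := by
    rcases hx with hx | hx
    exacts [hx.1, neg_pi_lt_zero.le.trans hx.1.le]
  rw [primitive, intervalIntegral.integral_of_le hx']
  refine setIntegral_congr_set (E := ℝ) ?_
  have hne : ∀ᵐ t ∂P.weight, t ≠ -Real.pi := by
    rw [ae_iff]
    simp
  have hne' : ∀ᵐ t ∂P.weight, t ≠ x := by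
    rw [ae_iff]
    simp
  filter_upwards [P.ae_mem_J, hne, hne'] with t ht h1 h2
  refine propext (show t ∈ Ioc (-Real.pi) x ↔ t ∈ Iio x from ⟨fun h => lt_of_le_of_ne h.2 h2,
    fun h => ⟨lt_of_le_of_ne ?_ h1.symm, le_of_lt h⟩⟩)
  rcases ht with ht | ht
  exacts [ht.1, neg_pi_lt_zero.le.trans ht.1.le]

theorem primitive_pi (h : ℝ → ℝ) : P.primitive h Real.pi = ∫ t, h t ∂P.weight := by
  rw [primitive_eq_setIntegral pi_mem_J, ← setIntegral_univ (μ := P.weight)]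
  refine setIntegral_congr_set (E := ℝ) ?_
  have hne' : ∀ᵐ t ∂P.weight, t ≠ Real.pi := by
    rw [ae_iff]
    simp
  filter_upwards [P.ae_mem_J, hne'] with t ht h2
  refine propext (show t ∈ Iio Real.pi ↔ t ∈ univ from ⟨fun _ => mem_univ t,
    fun _ => lt_of_le_of_ne ?_ h2⟩)
  rcases ht with ht | ht
  exacts [ht.2.le.trans Real.pi_pos.le, ht.2]

theorem primitive_of_neg (h12 : 0 < P.Δ₁₂) (h34 : 0 < P.Δ₃₄) {h : ℝ → ℝ}
    (hh : Integrable h P.weight) {x : ℝ} (hx : x ∈ Ico (-Real.pi) 0) :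
    P.primitive h x = P.Δ₃₄ / P.p₁ * ∫ t in (-Real.pi)..x, h t := by
  rw [primitive, intervalIntegral.integral_of_le hx.1, ← integral_indicator measurableSet_Ioc,
    integral_weight h12 h34 (hh.indicator measurableSet_Ioc),
    setIntegral_indicator measurableSet_Ioc, setIntegral_indicator measurableSet_Ioc]
  have e1 : Ico (-Real.pi) 0 ∩ Ioc (-Real.pi) x = Ioc (-Real.pi) x :=
    inter_eq_right.2 fun t ht => ⟨ht.1.le, ht.2.trans_lt hx.2⟩
  have e2 : Ioc 0 Real.pi ∩ Ioc (-Real.pi) x = ∅ := by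
    ext t
    simp only [mem_inter_iff, mem_Ioc, mem_empty_iff_false, iff_false]
    rintro ⟨⟨h1, -⟩, -, h2⟩
    linarith [hx.2]
  rw [e1, e2, intervalIntegral.integral_of_le hx.1]
  simp

theorem primitive_of_pos (h12 : 0 < P.Δ₁₂) (h34 : 0 < P.Δ₃₄) {h : ℝ → ℝ}
    (hh : Integrable h P.weight) {x : ℝ} (hx : x ∈ Ioc 0 Real.pi) :
    P.primitive h x = P.Δ₃₄ / P.p₁ * (∫ t in Ioo (-Real.pi) 0, h t) +
      P.Δ₁₂ / P.p₂ * ∫ t in (0 : ℝ)..x, h t := by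
  have hx' : -Real.pi ≤ x := neg_pi_lt_zero.le.trans hx.1.le
  rw [primitive, intervalIntegral.integral_of_le hx', ← integral_indicator measurableSet_Ioc,
    integral_weight h12 h34 (hh.indicator measurableSet_Ioc),
    setIntegral_indicator measurableSet_Ioc, setIntegral_indicator measurableSet_Ioc]
  have e1 : Ico (-Real.pi) 0 ∩ Ioc (-Real.pi) x = Ioo (-Real.pi) 0 := by
    ext t
    simp only [mem_inter_iff, mem_Ico, mem_Ioc, mem_Ioo]
    exact ⟨fun h => ⟨h.2.1, h.1.2⟩, fun h => ⟨⟨h.1.le, h.2⟩, h.1, h.2.le.trans hx.1.le⟩⟩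
  have e2 : Ioc 0 Real.pi ∩ Ioc (-Real.pi) x = Ioc 0 x := by
    ext t
    simp only [mem_inter_iff, mem_Ioc]
    exact ⟨fun h => ⟨h.1.1, h.2.2⟩,
      fun h => ⟨⟨h.1, h.2.trans hx.2⟩, neg_pi_lt_zero.trans h.1, h.2⟩⟩
  rw [e1, e2, intervalIntegral.integral_of_le hx.1.le]

/-- The density of the weight on `J`. -/
noncomputable def density (P : Problem) (x : ℝ) : ℝ :=
  if x < 0 then P.Δ₃₄ / P.p₁ else P.Δ₁₂ / P.p₂

theorem hasDerivWithinAt_primitive (h12 : 0 < P.Δ₁₂) (h34 : 0 < P.Δ₃₄) {h : ℝ → ℝ}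
    (hh : PiecewiseContinuous h) {x : ℝ} (hx : x ∈ J) :
    HasDerivWithinAt (P.primitive h) (P.density x * h x) J x := by
  have hi : Integrable h P.weight := (memLp_of_piecewiseContinuous hh).integrable (by norm_num)
  obtain ⟨hL, hR, cL, cR, eL, eR⟩ := hh
  have hx₀ := hx
  rcases hx with hx | hx
  · have hd : HasDerivWithinAt (fun y => P.Δ₃₄ / P.p₁ * ∫ t in (-Real.pi)..y, hL t)
        (P.Δ₃₄ / P.p₁ * hL x) J x :=
      ((cL.integral_hasStrictDerivAt _ x).hasDerivAt.const_mul _).hasDerivWithinAt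
    rw [density, if_pos hx.2, eL hx]
    have key : ∀ y ∈ Ico (-Real.pi) 0,
        P.primitive h y = P.Δ₃₄ / P.p₁ * ∫ t in (-Real.pi)..y, hL t := by
      intro y hy
      rw [primitive_of_neg h12 h34 hi hy]
      congr 1
      refine intervalIntegral.integral_congr fun t ht => eL ?_
      rw [uIcc_of_le hy.1] at ht
      exact ⟨ht.1, ht.2.trans_lt hy.2⟩
    refine hd.congr_of_eventuallyEq ?_ (key x hx)
    filter_upwards [self_mem_nhdsWithin, nhdsWithin_le_nhds (Iio_mem_nhds hx.2)] with y hy hy0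
    rcases hy with hy | hy
    exacts [key y hy, absurd hy.1 (not_lt_of_gt hy0)]
  · have hd : HasDerivWithinAt (fun y => P.Δ₃₄ / P.p₁ * (∫ t in Ioo (-Real.pi) 0, h t) +
        P.Δ₁₂ / P.p₂ * ∫ t in (0 : ℝ)..y, hR t) (P.Δ₁₂ / P.p₂ * hR x) J x :=
      (((cR.integral_hasStrictDerivAt _ x).hasDerivAt.const_mul _).const_add _).hasDerivWithinAt
    rw [density, if_neg hx.1.not_gt, eR hx]
    have key : ∀ y ∈ Ioc 0 Real.pi, P.primitive h y =
        P.Δ₃₄ / P.p₁ * (∫ t in Ioo (-Real.pi) 0, h t) +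
          P.Δ₁₂ / P.p₂ * ∫ t in (0 : ℝ)..y, hR t := by
      intro y hy
      rw [primitive_of_pos h12 h34 hi hy]
      congr 2
      refine intervalIntegral.integral_congr_ae (Eventually.of_forall fun t ht => eR ?_)
      rw [uIoc_of_le hy.1.le] at ht
      exact ⟨ht.1, ht.2.trans hy.2⟩
    refine hd.congr_of_eventuallyEq ?_ (key x hx)
    filter_upwards [self_mem_nhdsWithin, nhdsWithin_le_nhds (Ioi_mem_nhds hx.1)] with y hy hy0
    rcases hy with hy | hy
    exacts [absurd hy.2 (not_lt_of_gt hy0), key y hy]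

/-! ### Green's function -/

variable {lam : ℝ}

theorem Forced.congr_left {f y y₁ z : ℝ → ℝ} {yl yl' yr yr' : ℝ}
    (h : P.Forced lam f y y₁ yl yl' yr yr') (hz : EqOn z y J) :
    P.Forced lam f z y₁ yl yl' yr yr' :=
  { h with
    deriv_one := fun x hx => (h.deriv_one x hx).congr hz (hz hx)
    deriv_two := fun x hx => hz hx ▸ h.deriv_two x hx
    tendsto_left := h.tendsto_left.congr' <| by
      filter_upwards [Ico_mem_nhdsLT_zero] with x hx using (hz (Or.inl hx)).symm
    tendsto_right := h.tendsto_right.congr' <| by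
      filter_upwards [Ioc_mem_nhdsGT_zero] with x hx using (hz (Or.inr hx)).symm }

theorem Solves.congr_left {f y z : ℝ → ℝ} (h : P.Solves lam f y) (hz : EqOn z y J) :
    P.Solves lam f z := by
  obtain ⟨y₁, yl, yl', yr, yr', h, hl, hr⟩ := h
  refine ⟨y₁, yl, yl', yr, yr', h.congr_left hz, ?_, ?_⟩
  · unfold LeftBC
    rwa [hz neg_pi_mem_J]
  · unfold RightBC
    rwa [hz pi_mem_J]

/-- The function `-(χ ∫_{t < x} φ f + φ ∫_{t ≥ x} χ f) / om`, the integrals being taken with respect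
to the weight. -/
noncomputable def variationOfParameters (P : Problem) (om : ℝ) (φ χ f : ℝ → ℝ) (x : ℝ) : ℝ :=
  -(χ x * P.primitive (fun t => φ t * f t) x +
    φ x * ((∫ t, χ t * f t ∂P.weight) - P.primitive (fun t => χ t * f t) x)) / om

theorem solves_variationOfParameters (h12 : 0 < P.Δ₁₂) (h34 : 0 < P.Δ₃₄)
    {φ φ₁ χ χ₁ f : ℝ → ℝ} {φl φl' φr φr' χl χl' χr χr' om : ℝ}
    (hφ : P.Forced lam 0 φ φ₁ φl φl' φr φr') (hχ : P.Forced lam 0 χ χ₁ χl χl' χr χr')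
    (hφb : P.LeftBC φ φ₁) (hχb : P.RightBC χ χ₁) (hom : om ≠ 0)
    (hW : P.Δ₁₂ * (φr * χr' - φr' * χr) = om) (hf : PiecewiseContinuous f) :
    P.Solves lam f (P.variationOfParameters om φ χ f) := by
  have hφf := hφ.piecewiseContinuous.mul hf
  have hχf := hχ.piecewiseContinuous.mul hf
  set A := P.primitive fun t => φ t * f t with hA
  set B := P.primitive fun t => χ t * f t with hB
  set I := ∫ t, χ t * f t ∂P.weight with hI
  have dA : ∀ x ∈ J, HasDerivWithinAt A (P.density x * (φ x * f x)) J x := fun x hx =>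
    hasDerivWithinAt_primitive h12 h34 hφf hx
  have dB : ∀ x ∈ J, HasDerivWithinAt B (P.density x * (χ x * f x)) J x := fun x hx =>
    hasDerivWithinAt_primitive h12 h34 hχf hx
  have cA : Continuous A :=
    primitive_continuous ((memLp_of_piecewiseContinuous hφf).integrable (by norm_num))
  have cB : Continuous B :=
    primitive_continuous ((memLp_of_piecewiseContinuous hχf).integrable (by norm_num))
  have wr : ∀ x ∈ J, P.density x * P.p x * (φ x * χ₁ x - φ₁ x * χ x) = om := by
    rintro x (hx | hx)
    · rw [hφ.wronskian_left hχ hx, density, if_pos hx.2, p_of_neg hx.2,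
        div_mul_cancel₀ _ P.p₁_pos.ne', hφ.transmits.wronskian hχ.transmits, hW]
    · rw [hφ.wronskian_right hχ hx, density, if_neg hx.1.not_gt, p_of_pos hx.1,
        div_mul_cancel₀ _ P.p₂_pos.ne', hW]
  have lim : ∀ {u v : ℝ → ℝ} {c d : ℝ} {s : Set ℝ}, Tendsto u (𝓝[s] 0) (𝓝 c) →
      Tendsto v (𝓝[s] 0) (𝓝 d) → Tendsto (fun x => -(u x * A x + v x * (I - B x)) / om) (𝓝[s] 0)
        (𝓝 (-(c * A 0 + d * (I - B 0)) / om)) := by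
    intro u v c d s hu hv
    exact ((hu.mul (cA.continuousAt.tendsto.mono_left nhdsWithin_le_nhds)).add
      (hv.mul (tendsto_const_nhds.sub
        (cB.continuousAt.tendsto.mono_left nhdsWithin_le_nhds)))).neg.div_const om
  refine ⟨fun x => -(χ₁ x * A x + φ₁ x * (I - B x)) / om, _, _, _, _,
    ⟨fun x hx => ?_, fun x hx => ?_, lim hχ.tendsto_left hφ.tendsto_left,
      lim hχ.tendsto_left' hφ.tendsto_left', lim hχ.tendsto_right hφ.tendsto_right,
      lim hχ.tendsto_right' hφ.tendsto_right', fun i => ?_⟩, ?_, ?_⟩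
  · refine ((((hχ.deriv_one x hx).mul (dA x hx)).add ((hφ.deriv_one x hx).mul
      ((dB x hx).const_sub I))).neg.div_const om).congr_deriv ?_
    ring
  · refine ((((hχ.deriv_two x hx).mul (dA x hx)).add ((hφ.deriv_two x hx).mul
      ((dB x hx).const_sub I))).neg.div_const om).congr_deriv ?_
    have hp := (P.p_pos x).ne'
    simp only [Pi.zero_apply, sub_zero, variationOfParameters]
    rw [← hA, ← hB]
    field_simp
    linear_combination -f x * wr x hx
  · linear_combination -A 0 / om * hχ.transmits i - (I - B 0) / om * hφ.transmits i
  · unfold LeftBC variationOfParameters at *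
    rw [hA, hB]
    simp only [primitive_neg_pi]
    linear_combination -I / om * hφb
  · unfold RightBC variationOfParameters at *
    rw [hA, hB]
    simp only [primitive_pi, sub_self]
    linear_combination -(∫ t, φ t * f t ∂P.weight) / om * hχb

/-- Green's function. If `lam` is a real number that is not an eigenvalue, a solution `φ` satisfying
the boundary condition at `-π` and a solution `χ` satisfying the one at `π` are linearly
independent, and the symmetric kernel `-φ (min x t) χ (max x t) / om` inverts the problem. -/
theorem exists_greenKernel (h12 : 0 < P.Δ₁₂) (h34 : 0 < P.Δ₃₄)
    (hlam : ∀ y, P.Solves lam 0 y → ∀ x ∈ J, y x = 0) :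
    ∃ k : ℝ → ℝ → ℝ, StronglyMeasurable (Function.uncurry k) ∧ (∃ C, ∀ x t, |k x t| ≤ C) ∧
      (∀ x t, k x t = k t x) ∧
      (∀ f, MemLp f 2 P.weight → PiecewiseContinuous fun x => ∫ t, k x t * f t ∂P.weight) ∧
      ∀ f, PiecewiseContinuous f → P.Solves lam f fun x => ∫ t, k x t * f t ∂P.weight := by
  obtain ⟨φ₀, φ₁, φl, φl', φr, φr', hφ₀, eφ, eφ₁⟩ :=
    P.exists_forced_of_left_data h12.ne' lam (Real.sin P.α) (-Real.cos P.α)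
  obtain ⟨χ₀, χ₁, χl, χl', χr, χr', hχ₀, eχ, eχ₁⟩ :=
    P.exists_forced_of_right_data h34.ne' lam (Real.sin P.β) (-Real.cos P.β)
  obtain ⟨φ, mφ, ⟨Cφ, bφ⟩, heqφ⟩ := hφ₀.piecewiseContinuous.exists_bounded
  obtain ⟨χ, mχ, ⟨Cχ, bχ⟩, heqχ⟩ := hχ₀.piecewiseContinuous.exists_bounded
  have hφ := hφ₀.congr_left heqφ.symm
  have hχ := hχ₀.congr_left heqχ.symm
  rw [heqφ neg_pi_mem_J] at eφ
  rw [heqχ pi_mem_J] at eχ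
  clear hφ₀ hχ₀ heqφ heqχ
  have hφb : P.LeftBC φ φ₁ := by
    unfold LeftBC
    rw [eφ, eφ₁]
    ring
  have hχb : P.RightBC χ χ₁ := by
    unfold RightBC
    rw [eχ, eχ₁]
    ring
  set om := P.Δ₁₂ * (φr * χr' - φr' * χr) with hom_def
  -- A vanishing Wronskian at `π` means that `φ` also satisfies the boundary condition there. As `lam`
  -- is not an eigenvalue, `φ` is then zero, which contradicts its data `(sin α, -cos α)` at `-π`.
  have hom : om ≠ 0 := by
    intro h0
    have hw : φr * χr' - φr' * χr = 0 := (mul_eq_zero.1 h0).resolve_left h12.ne'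
    rw [← hφ.wronskian_right hχ (right_mem_Ioc.2 Real.pi_pos), eχ, eχ₁] at hw
    have hφr : P.RightBC φ φ₁ := by
      unfold RightBC
      linear_combination -hw
    have hzero := hlam φ ⟨φ₁, φl, φl', φr, φr', hφ, hφb, hφr⟩
    have e0 : Real.sin P.α = 0 := by rw [← eφ, hzero _ neg_pi_mem_J]
    have hd : HasDerivWithinAt φ 0 J (-Real.pi) :=
      (hasDerivWithinAt_const (-Real.pi) J 0).congr hzero (hzero _ neg_pi_mem_J)
    have hu : UniqueDiffWithinAt ℝ J (-Real.pi) :=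
      (uniqueDiffOn_Ico (-Real.pi) 0 _ (left_mem_Ico.2 neg_pi_lt_zero)).mono subset_union_left
    have e1 : Real.cos P.α = 0 := by
      have := hu.eq_deriv _ (hφ.deriv_one _ neg_pi_mem_J) hd
      linarith
    have := Real.sin_sq_add_cos_sq P.α
    rw [e0, e1] at this
    norm_num at this
  have pφ := hφ.piecewiseContinuous
  have pχ := hχ.piecewiseContinuous
  have hmul : ∀ {u f : ℝ → ℝ}, PiecewiseContinuous u → MemLp f 2 P.weight →
      Integrable (fun t => u t * f t) P.weight := fun hu hf =>
    (memLp_of_piecewiseContinuous hu).integrable_mul hf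
  have key : ∀ f, MemLp f 2 P.weight → EqOn
      (fun x => ∫ t, -(φ (min x t) * χ (max x t)) / om * f t ∂P.weight)
      (P.variationOfParameters om φ χ f) J := by
    intro f hf x hx
    have i1 := hmul pφ hf
    have i2 := hmul pχ hf
    have e : ∀ t, -(φ (min x t) * χ (max x t)) / om * f t =
        (-χ x / om) * (Iio x).indicator (fun t => φ t * f t) t +
          (-φ x / om) * (χ t * f t - (Iio x).indicator (fun t => χ t * f t) t) := by
      intro t
      by_cases ht : t < x
      · rw [indicator_of_mem (mem_Iio.2 ht), indicator_of_mem (mem_Iio.2 ht), min_eq_right ht.le,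
          max_eq_left ht.le]
        ring
      · rw [indicator_of_notMem (by simpa using ht), indicator_of_notMem (by simpa using ht),
          min_eq_left (not_lt.1 ht), max_eq_right (not_lt.1 ht)]
        ring
    have j1 := i1.indicator (measurableSet_Iio (a := x))
    have j2 := i2.indicator (measurableSet_Iio (a := x))
    have j3 : Integrable (fun t => χ t * f t - (Iio x).indicator (fun t => χ t * f t) t) P.weight :=
      i2.sub j2
    simp only [e]
    rw [integral_add (j1.const_mul _) (j3.const_mul _), integral_const_mul,
      integral_const_mul, integral_sub i2 j2, integral_indicator measurableSet_Iio,
      integral_indicator measurableSet_Iio, ← primitive_eq_setIntegral hx,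
      ← primitive_eq_setIntegral hx, variationOfParameters]
    ring
  refine ⟨fun x t => -(φ (min x t) * χ (max x t)) / om, ?_, ⟨Cφ * Cχ / |om|, fun x t => ?_⟩,
    fun x t => ?_, fun f hf => ?_, fun f hf => ?_⟩
  · refine Measurable.stronglyMeasurable ?_
    exact (((mφ.comp (measurable_fst.min measurable_snd)).mul
      (mχ.comp (measurable_fst.max measurable_snd))).neg).div_const om
  · rw [abs_div, abs_neg, abs_mul]
    gcongr
    · exact (abs_nonneg _).trans (bφ 0)
    · exact bφ _
    · exact bχ _
  · simp only [min_comm, max_comm]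
  · refine PiecewiseContinuous.congr ?_ (key f hf)
    have := (pχ.mul (.of_continuous (primitive_continuous (hmul pφ hf)))).linComb
      (pφ.mul (.of_continuous ((continuous_const (y := ∫ t, χ t * f t ∂P.weight)).sub
        (primitive_continuous (hmul pχ hf))))) (-1 / om) (-1 / om)
    refine this.congr fun x _ => ?_
    simp only [variationOfParameters, Pi.sub_apply]
    ring
  · exact (solves_variationOfParameters h12 h34 hφ hχ hφb hχb hom rfl hf).congr_left
      (key f (memLp_of_piecewiseContinuous hf))

/-! ### Completeness of the eigenfunctions -/

/-- `mu` is a real eigenvalue. -/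
def IsRealEigenvalue (P : Problem) (mu : ℝ) : Prop :=
  ∃ y, P.Solves mu 0 y ∧ ∃ x ∈ J, y x ≠ 0

theorem Solves.const_mul {f y : ℝ → ℝ} (h : P.Solves lam f y) (c : ℝ) :
    P.Solves lam (fun x => c * f x) (fun x => c * y x) :=
  ((h.linComb h c 0).congr_right fun x _ => by ring).congr_left fun x _ => by ring

theorem IsRealEigenvalue.exists_normalized (h12 : 0 < P.Δ₁₂) (h34 : 0 < P.Δ₃₄) {mu : ℝ}
    (h : P.IsRealEigenvalue mu) : ∃ y, P.Solves mu 0 y ∧ P.inn y y = 1 := by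
  obtain ⟨y, hy, x, hx, hne⟩ := h
  have hpos : 0 < P.inn y y := by
    by_contra! h
    exact hne (eq_zero_of_inn_self h12 h34 hy.piecewiseContinuous h x hx)
  have hsq : ∀ c, P.inn (fun x => c * y x) (fun x => c * y x) = c * c * P.inn y y := by
    intro c
    rw [inn_const_mul_left, inn_comm, inn_const_mul_left, mul_assoc]
  refine ⟨fun x => (√(P.inn y y))⁻¹ * y x, (hy.const_mul _).congr_right fun x _ => by simp, ?_⟩
  rw [hsq, ← mul_inv, Real.mul_self_sqrt hpos.le, inv_mul_cancel₀ hpos.ne']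

theorem exists_ne_zero_of_inn_self {y : ℝ → ℝ} (h : P.inn y y = 1) : ∃ x ∈ J, y x ≠ 0 := by
  by_contra! hy
  have : P.inn y y = P.inn 0 0 := inn_congr (fun x hx => hy x hx) fun x hx => hy x hx
  rw [h] at this
  simp [inn] at this

theorem orthonormal_of_solves (h12 : 0 < P.Δ₁₂) (h34 : 0 < P.Δ₃₄) {ι : Type*} {lam : ι → ℝ}
    (hinj : Function.Injective lam) {φ : ι → ℝ → ℝ} (hφ : ∀ i, P.Solves (lam i) 0 (φ i))
    (hn : ∀ i, P.inn (φ i) (φ i) = 1) (hm : ∀ i, MemLp (φ i) 2 P.weight) :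
    Orthonormal ℝ fun i => (hm i).toLp := by
  classical
  rw [orthonormal_iff_ite]
  intro i j
  rw [← inn_eq_inner h12 h34]
  split_ifs with h
  · rw [h, hn]
  · exact inn_eq_zero_of_ne (hφ i) (hφ j) (hinj.ne h)

/-- There are at most countably many real eigenvalues, because the modified Hilbert space is
separable. -/
theorem countable_isRealEigenvalue (h12 : 0 < P.Δ₁₂) (h34 : 0 < P.Δ₃₄) :
    {mu : ℝ | P.IsRealEigenvalue mu}.Countable := by
  choose φ hφ hn using fun mu : {mu : ℝ | P.IsRealEigenvalue mu} => mu.2.exists_normalized h12 h34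
  have hm := fun mu => P.memLp_of_piecewiseContinuous (hφ mu).piecewiseContinuous
  have ho := orthonormal_of_solves h12 h34 Subtype.val_injective hφ hn hm
  have : Fact ((2 : ENNReal) ≠ ⊤) := ⟨by norm_num⟩
  have hc := PairwiseDisjoint.countable_of_isOpen (a := univ)
    (s := fun mu => Metric.ball (hm mu).toLp (1 / 2)) (fun i _ j _ hij => ?_)
    (fun _ _ => Metric.isOpen_ball) fun _ _ => Metric.nonempty_ball.2 (by norm_num)
  · rw [countable_univ_iff] at hc
    exact hc
  · refine Metric.ball_disjoint_ball ?_
    have h2 : ‖(hm i).toLp - (hm j).toLp‖ ^ 2 = 2 := by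
      rw [norm_sub_sq_real, ho.1 i, ho.1 j, ho.2 hij]
      norm_num
    rw [dist_eq_norm]
    nlinarith [norm_nonneg ((hm i).toLp - (hm j).toLp)]

open scoped ContDiff in
/-- A smooth function with compact support in `(-π, 0) ∪ (0, π)` satisfies all boundary and
transmission conditions. -/
theorem solves_of_contDiff {g : ℝ → ℝ} (hg : ContDiff ℝ ∞ g)
    (hs : tsupport g ⊆ Ioo (-Real.pi) 0 ∪ Ioo 0 Real.pi) (lam : ℝ) :
    ∃ f, PiecewiseContinuous f ∧ P.Solves lam f g := by
  have h1 : ∀ x, HasDerivAt g (deriv g x) x := fun x =>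
    (hg.differentiable (by simp)).differentiableAt.hasDerivAt
  have hg' : ContDiff ℝ ∞ (deriv g) := hg.iterate_deriv 1
  have h2 : ∀ x, HasDerivAt (deriv g) (deriv (deriv g) x) x := fun x =>
    (hg'.differentiable (by simp)).differentiableAt.hasDerivAt
  have hg'' : Continuous (deriv (deriv g)) := (hg.iterate_deriv 2).continuous
  have z1 : ∀ x, x ∉ Ioo (-Real.pi) 0 ∪ Ioo 0 Real.pi → g x = 0 := fun x hx =>
    image_eq_zero_of_notMem_tsupport fun h => hx (hs h)
  have z2 : ∀ x, x ∉ Ioo (-Real.pi) 0 ∪ Ioo 0 Real.pi → deriv g x = 0 := fun x hx =>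
    image_eq_zero_of_notMem_tsupport fun h => hx (hs (tsupport_deriv_subset h))
  have n1 : -Real.pi ∉ Ioo (-Real.pi) 0 ∪ Ioo 0 Real.pi := by
    rintro (h | h)
    exacts [lt_irrefl _ h.1, absurd h.1 neg_pi_lt_zero.not_gt]
  have n2 : (0 : ℝ) ∉ Ioo (-Real.pi) 0 ∪ Ioo 0 Real.pi := by
    rintro (h | h)
    exacts [lt_irrefl _ h.2, lt_irrefl _ h.1]
  have n3 : Real.pi ∉ Ioo (-Real.pi) 0 ∪ Ioo 0 Real.pi := by
    rintro (h | h)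
    exacts [absurd h.2 Real.pi_pos.not_gt, lt_irrefl _ h.2]
  have hp : PiecewiseContinuous P.p := ⟨fun _ => P.p₁, fun _ => P.p₂, continuous_const,
    continuous_const, fun x hx => p_of_neg hx.2, fun x hx => p_of_pos hx.1⟩
  have ht : ∀ {u : ℝ → ℝ} {s : Set ℝ}, Continuous u → u 0 = 0 → Tendsto u (𝓝[s] 0) (𝓝 0) := by
    intro u s hu h0
    have := (hu.tendsto 0).mono_left (nhdsWithin_le_nhds (s := s))
    rwa [h0] at this
  refine ⟨fun x => 1 * ((P.q x - lam) * g x) + (-1) * (P.p x * deriv (deriv g) x), ?_, deriv g,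
    0, 0, 0, 0, ⟨fun x _ => (h1 x).hasDerivWithinAt, fun x _ => ?_, ht hg.continuous (z1 0 n2),
      ht hg'.continuous (z2 0 n2), ht hg.continuous (z1 0 n2), ht hg'.continuous (z2 0 n2),
      fun i => by ring⟩, ?_, ?_⟩
  · refine PiecewiseContinuous.linComb (.mul ?_ (.of_continuous hg.continuous))
      (hp.mul (.of_continuous hg'')) 1 (-1)
    exact P.piecewiseContinuous_q.comp₂ P.piecewiseContinuous_q (F := fun a _ => a - lam)
      (by fun_prop)
  · refine (h2 x).hasDerivWithinAt.congr_deriv ?_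
    rw [eq_div_iff (P.p_pos x).ne']
    ring
  · unfold LeftBC
    rw [z1 _ n1, z2 _ n1]
    ring
  · unfold RightBC
    rw [z1 _ n3, z2 _ n3]
    ring

/-- A square-integrable function orthogonal to all eigenfunctions is zero. Green's function at a
real number which is not an eigenvalue defines a compact symmetric operator. It is injective since
its range contains the test functions, and its eigenvectors are the eigenfunctions of the problem,
so that the spectral theorem applies. -/
theorem eq_zero_of_forall_inner_eq_zero (h12 : 0 < P.Δ₁₂) (h34 : 0 < P.Δ₃₄)
    {F : Lp ℝ 2 P.weight} (hF : ∀ mu v, P.Solves mu 0 v → (∃ x ∈ J, v x ≠ 0) →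
      ∀ hv : MemLp v 2 P.weight, inner ℝ hv.toLp F = 0) : F = 0 := by
  obtain ⟨lam, hlam⟩ : ∃ lam, ¬ P.IsRealEigenvalue lam := by
    by_contra! h
    refine not_countable_univ (α := ℝ) ((countable_isRealEigenvalue h12 h34 (P := P)).mono ?_)
    exact fun x _ => h x
  have hlam' : ∀ y, P.Solves lam 0 y → ∀ x ∈ J, y x = 0 := by
    intro y hy
    by_contra! h
    exact hlam ⟨y, hy, h⟩
  obtain ⟨k, hk, ⟨C, hC⟩, hsymm, hpc, hsol⟩ := exists_greenKernel h12 h34 hlam'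
  obtain ⟨K, hK, hcomp, hKs⟩ := exists_compact_symmetric_integralOperator P.weight hk hC hsymm
  have hinj : ∀ f : Lp ℝ 2 P.weight, K f = 0 → f = 0 := by
    intro f hf
    have hfi : Integrable f P.weight := (Lp.memLp f).integrable (by norm_num)
    have hae := (isOpen_Ioo.union isOpen_Ioo :
        IsOpen (Ioo (-Real.pi) 0 ∪ Ioo 0 Real.pi)).ae_eq_zero_of_integral_contDiff_smul_eq_zero
      (hfi.locallyIntegrable.locallyIntegrableOn _) (fun g hg _ hs => ?_)
    · have e1 : ∀ᵐ x ∂P.weight, x ≠ -Real.pi := by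
        rw [ae_iff]
        simp
      have e2 : ∀ᵐ x ∂P.weight, x ≠ Real.pi := by
        rw [ae_iff]
        simp
      refine (Lp.eq_zero_iff_ae_eq_zero).2 ?_
      filter_upwards [hae, P.ae_mem_J, e1, e2] with x hx hxJ h1 h2
      refine hx ?_
      rcases hxJ with h | h
      · exact Or.inl ⟨lt_of_le_of_ne h.1 h1.symm, h.2⟩
      · exact Or.inr ⟨h.1, lt_of_le_of_ne h.2 h2⟩
    · obtain ⟨r, hr, hgs⟩ := P.solves_of_contDiff hg hs lam
      have hrm := P.memLp_of_piecewiseContinuous hr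
      have hgr : EqOn g (fun x => ∫ t, k x t * r t ∂P.weight) J := by
        intro x hx
        have hd := (hgs.linComb (hsol r hr) 1 (-1)).congr_right (g := 0) fun x _ => by simp
        have := hlam' _ hd x hx
        linear_combination this
      have hKr : K hrm.toLp =ᵐ[P.weight] g := by
        filter_upwards [hK hrm.toLp, P.ae_mem_J] with x hx hxJ
        rw [hx, hgr hxJ]
        refine integral_congr_ae ?_
        filter_upwards [hrm.coeFn_toLp] with t ht
        rw [ht]
      have h0 : inner ℝ f (K hrm.toLp) = 0 := by
        have := hKs f hrm.toLp
        change inner ℝ (K f) hrm.toLp = inner ℝ f (K hrm.toLp) at this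
        rw [← this, hf, inner_zero_left]
      rw [L2.inner_def] at h0
      rw [← h0]
      refine integral_congr_ae ?_
      filter_upwards [hKr] with x hx
      simp [hx]
  have heig : ∀ (κ : ℝ) (e : Lp ℝ 2 P.weight), K e = κ • e → inner ℝ e F = 0 := by
    intro κ e he
    by_cases he0 : e = 0
    · rw [he0, inner_zero_left]
    have hκ : κ ≠ 0 := by
      rintro rfl
      exact he0 (hinj e (by rw [he, zero_smul]))
    -- The image of `e` under the kernel, divided by `κ`, is a piecewise continuous representative.
    set v : ℝ → ℝ := fun x => κ⁻¹ * ∫ t, k x t * e t ∂P.weight with hv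
    have hvc : PiecewiseContinuous v := (hpc e (Lp.memLp e)).const_mul _
    have hve : v =ᵐ[P.weight] e := by
      filter_upwards [hK e, Lp.coeFn_smul κ e] with x h1 h2
      rw [he, h2] at h1
      rw [hv]
      simp only
      rw [← h1, Pi.smul_apply, smul_eq_mul, inv_mul_cancel_left₀ hκ]
    have hvm := P.memLp_of_piecewiseContinuous hvc
    have hvs : P.Solves (lam + κ⁻¹) 0 v := by
      have h1 : P.Solves lam v fun x => κ * v x := by
        refine (hsol v hvc).congr_left fun x _ => ?_
        have hint : ∫ t, k x t * v t ∂P.weight = ∫ t, k x t * e t ∂P.weight := by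
          refine integral_congr_ae ?_
          filter_upwards [hve] with t ht
          rw [ht]
        simp only [hint]
        simp only [hv, mul_inv_cancel_left₀ hκ]
      have h2 : P.Solves lam (fun x => κ⁻¹ * v x) v :=
        (h1.const_mul κ⁻¹).congr_left fun x _ => (inv_mul_cancel_left₀ hκ _).symm
      refine (h2.change_parameter (lam + κ⁻¹)).congr_right fun x _ => ?_
      simp only [Pi.zero_apply]
      ring
    have hev : hvm.toLp = e := Lp.ext (hvm.coeFn_toLp.trans hve)
    rw [← hev]
    refine hF _ v hvs ?_ hvm
    by_contra! h
    refine he0 ((Lp.eq_zero_iff_ae_eq_zero).2 (hve.symm.trans ?_))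
    filter_upwards [P.ae_mem_J] with x hx using h x hx
  have hbot := ContinuousLinearMap.orthogonalComplement_iSup_eigenspaces_eq_bot hcomp hKs
  rw [← Submodule.mem_bot ℝ, ← hbot, Submodule.mem_orthogonal]
  intro e he
  induction he using Submodule.iSup_induction' with
  | mem κ e he => exact heig κ e (Module.End.mem_eigenspace_iff.1 he)
  | zero => exact inner_zero_left _
  | add x y _ _ hx hy => rw [inner_add_left, hx, hy, add_zero]

/-- The modified Hilbert space is infinite-dimensional, since it contains the polynomials. -/
theorem not_finiteDimensional (h12 : 0 < P.Δ₁₂) (h34 : 0 < P.Δ₃₄) :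
    ¬ FiniteDimensional ℝ (Lp ℝ 2 P.weight) := by
  intro hfin
  have hm : ∀ p : Polynomial ℝ, MemLp (fun x => p.eval x) 2 P.weight := fun p =>
    P.memLp_of_piecewiseContinuous (.of_continuous p.continuous)
  let L : Polynomial ℝ →ₗ[ℝ] Lp ℝ 2 P.weight :=
    { toFun := fun p => (hm p).toLp
      map_add' := by
        intro p q
        rw [← MemLp.toLp_add]
        exact MemLp.toLp_congr _ _ (Eventually.of_forall fun x => Polynomial.eval_add)
      map_smul' := by
        intro c p
        rw [RingHom.id_apply, ← MemLp.toLp_const_smul]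
        exact MemLp.toLp_congr _ _ (Eventually.of_forall fun x => Polynomial.eval_smul ..) }
  refine Polynomial.not_finite (R := ℝ) (Module.Finite.of_injective L ?_)
  rw [← LinearMap.ker_eq_bot, LinearMap.ker_eq_bot']
  intro p hp
  have h0 : ∀ᵐ x ∂P.weight, p.eval x = 0 :=
    (hm p).coeFn_toLp.symm.trans ((Lp.eq_zero_iff_ae_eq_zero).1 hp)
  have h1 := ((ae_weight_iff h12 h34).1 h0).2
  by_contra hne
  have hz : ∀ᵐ x ∂volume.restrict (Ioc 0 Real.pi), x ∉ (p.roots.toFinset : Set ℝ) := by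
    refine ae_restrict_of_ae ?_
    rw [ae_iff]
    simp only [not_not]
    exact p.roots.toFinset.finite_toSet.measure_zero volume
  have hF : ∀ᵐ x ∂volume.restrict (Ioc 0 Real.pi), False := by
    filter_upwards [h1, hz] with x hx hx'
    exact hx' (by simpa [hne] using hx)
  rw [eventually_false_iff_eq_bot, ae_eq_bot, Measure.restrict_eq_zero, Real.volume_Ioc] at hF
  simp [Real.pi_pos.not_ge] at hF

theorem infinite_isRealEigenvalue (h12 : 0 < P.Δ₁₂) (h34 : 0 < P.Δ₃₄) :
    {mu : ℝ | P.IsRealEigenvalue mu}.Infinite := by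
  intro hfin
  have := hfin.to_subtype
  choose φ hφ hn using fun mu : {mu : ℝ | P.IsRealEigenvalue mu} => mu.2.exists_normalized h12 h34
  have hm := fun mu => P.memLp_of_piecewiseContinuous (hφ mu).piecewiseContinuous
  set V := Submodule.span ℝ (range fun mu => (hm mu).toLp) with hV
  have : FiniteDimensional ℝ V := FiniteDimensional.span_of_finite ℝ (finite_range _)
  have hbot : Vᗮ = ⊥ := by
    rw [Submodule.eq_bot_iff]
    intro F hF
    refine eq_zero_of_forall_inner_eq_zero h12 h34 fun mu v hv hne hvm => ?_
    let i : {mu : ℝ | P.IsRealEigenvalue mu} := ⟨mu, v, hv, hne⟩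
    obtain ⟨c, hc⟩ := (hφ i).exists_eq_const_mul h12.ne' hv (exists_ne_zero_of_inn_self (hn i))
    have : hvm.toLp = c • (hm i).toLp := by
      rw [← MemLp.toLp_const_smul]
      exact MemLp.toLp_congr _ _ (ae_eq_of_eqOn fun x hx => hc x hx)
    rw [this, inner_smul_left, (Submodule.mem_orthogonal V F).1 hF _
      (Submodule.subset_span (mem_range_self i)), mul_zero]
  rw [Submodule.orthogonal_eq_bot_iff] at hbot
  refine not_finiteDimensional (P := P) h12 h34 ?_
  rw [hbot] at this
  exact Module.Finite.equiv Submodule.topEquiv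

/-! ### Eigensystems -/

theorem exists_isEigensystem (h12 : 0 < P.Δ₁₂) (h34 : 0 < P.Δ₃₄) :
    ∃ (lam : ℕ → ℝ) (φ : ℕ → ℝ → ℝ), P.IsEigensystem lam φ := by
  have hc := (countable_isRealEigenvalue (P := P) h12 h34).to_subtype
  have hi := (infinite_isRealEigenvalue (P := P) h12 h34).to_subtype
  obtain ⟨hd⟩ := nonempty_denumerable {mu : ℝ | P.IsRealEigenvalue mu}
  let e : ℕ ≃ {mu : ℝ | P.IsRealEigenvalue mu} := (Denumerable.eqv _).symm
  choose φ hφ hn using fun n => (e n).2.exists_normalized h12 h34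
  refine ⟨fun n => e n, φ, Subtype.val_injective.comp e.injective, ?_, fun n => ?_, hn⟩
  · ext mu
    constructor
    · rintro ⟨n, rfl⟩
      obtain ⟨y, hy, hne⟩ := (e n).2
      exact ofReal_mem_eigenvalues hy hne
    · intro hmu
      obtain ⟨lam, y, rfl, hy, hne⟩ := exists_real_of_mem_eigenvalues h12 h34 hmu
      exact ⟨e.symm ⟨lam, y, hy, hne⟩, by simp⟩
  · exact isEigenfunction_iff.2 ⟨hφ n, exists_ne_zero_of_inn_self (hn n)⟩

namespace IsEigensystem

variable {lam : ℕ → ℝ} {φ : ℕ → ℝ → ℝ}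

theorem solves (h : P.IsEigensystem lam φ) (n : ℕ) : P.Solves (lam n) 0 (φ n) :=
  (isEigenfunction_iff.1 (h.eigenfunction n)).1

theorem memLp (h : P.IsEigensystem lam φ) (n : ℕ) : MemLp (φ n) 2 P.weight :=
  P.memLp_of_piecewiseContinuous (h.solves n).piecewiseContinuous

theorem orthogonal_span_eq_bot (h : P.IsEigensystem lam φ) (h12 : 0 < P.Δ₁₂) (h34 : 0 < P.Δ₃₄) :
    (Submodule.span ℝ (range fun n => (h.memLp n).toLp))ᗮ = ⊥ := by
  rw [Submodule.eq_bot_iff]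
  intro F hF
  refine eq_zero_of_forall_inner_eq_zero h12 h34 fun mu v hv hne hvm => ?_
  obtain ⟨n, hn⟩ : (mu : ℂ) ∈ range fun n => (lam n : ℂ) := by
    rw [h.range_eq]
    exact ofReal_mem_eigenvalues hv hne
  obtain rfl : lam n = mu := Complex.ofReal_injective hn
  obtain ⟨c, hc⟩ := (h.solves n).exists_eq_const_mul h12.ne' hv
    (isEigenfunction_iff.1 (h.eigenfunction n)).2
  have : hvm.toLp = c • (h.memLp n).toLp := by
    rw [← MemLp.toLp_const_smul]
    exact MemLp.toLp_congr _ _ (ae_eq_of_eqOn fun x hx => hc x hx)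
  rw [this, inner_smul_left, (Submodule.mem_orthogonal _ F).1 hF _
    (Submodule.subset_span (mem_range_self n)), mul_zero]

theorem exists_hilbertBasis (h : P.IsEigensystem lam φ) (h12 : 0 < P.Δ₁₂) (h34 : 0 < P.Δ₃₄) :
    ∃ b : HilbertBasis ℕ ℝ (Lp ℝ 2 P.weight), ∀ n, b n = (h.memLp n).toLp := by
  refine ⟨HilbertBasis.mkOfOrthogonalEqBot (orthonormal_of_solves h12 h34 h.injective h.solves
    h.normalized h.memLp) (h.orthogonal_span_eq_bot h12 h34), fun n => ?_⟩
  rw [HilbertBasis.coe_mkOfOrthogonalEqBot]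

/-- The quantity in question is the squared distance in the modified Hilbert space between `f` and
a partial sum of its expansion in the Hilbert basis of eigenfunctions. -/
theorem tendsto_partialSum (h : P.IsEigensystem lam φ) (h12 : 0 < P.Δ₁₂) (h34 : 0 < P.Δ₃₄)
    {f : ℝ → ℝ} (hf : MemLp f 2 P.weight) :
    Tendsto (fun n : ℕ => P.inn (fun x => f x - ∑ k ∈ Finset.range (n + 1), P.inn f (φ k) * φ k x)
      fun x => f x - ∑ k ∈ Finset.range (n + 1), P.inn f (φ k) * φ k x) atTop (𝓝 0) := by
  obtain ⟨b, hb⟩ := h.exists_hilbertBasis h12 h34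
  have hsum := (b.hasSum_repr hf.toLp).tendsto_sum_nat.comp (tendsto_add_atTop_nat 1)
  have hnorm := ((tendsto_const_nhds (x := hf.toLp)).sub hsum).norm.pow 2
  rw [sub_self, norm_zero, zero_pow two_ne_zero] at hnorm
  refine hnorm.congr fun n => ?_
  have hs : MemLp (fun x => ∑ k ∈ Finset.range (n + 1), P.inn f (φ k) * φ k x) 2 P.weight :=
    memLp_finsetSum _ fun k _ => (h.memLp k).const_mul _
  have hd : MemLp (fun x => f x - ∑ k ∈ Finset.range (n + 1), P.inn f (φ k) * φ k x) 2 P.weight :=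
    hf.sub hs
  rw [inn_eq_inner h12 h34 hd hd, real_inner_self_eq_norm_sq]
  congr 2
  have e1 : hd.toLp = hf.toLp - hs.toLp := MemLp.toLp_sub hf hs
  rw [e1]
  congr 1
  refine Lp.ext ?_
  have hc : ∀ k, b.repr hf.toLp k = P.inn f (φ k) := fun k => by
    rw [b.repr_apply_apply, hb, ← inn_eq_inner h12 h34, inn_comm]
  have hall : ∀ᵐ x ∂P.weight, ∀ k, (b k : ℝ → ℝ) x = φ k x := ae_all_iff.2 fun k => by
    rw [hb]
    exact (h.memLp k).coeFn_toLp
  have hsmul : ∀ᵐ x ∂P.weight, ∀ k, (b.repr hf.toLp k • b k : Lp ℝ 2 P.weight) x =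
      b.repr hf.toLp k * (b k : ℝ → ℝ) x := ae_all_iff.2 fun k => Lp.coeFn_smul _ _
  filter_upwards [hs.coeFn_toLp, hall, hsmul, Lp.coeFn_fun_finsetSum (Finset.range (n + 1))
    fun k => b.repr hf.toLp k • b k] with x h1 h2 h3 h4
  rw [h1]
  refine h4.trans ?_
  refine Finset.sum_congr rfl fun k _ => ?_
  rw [h3, h2, hc]

end IsEigensystem

end Problem

end TwoIntervalSL

theorem mainTheorem4 (P : TwoIntervalSL.Problem) (h12 : 0 < P.Δ₁₂) (h34 : 0 < P.Δ₃₄) :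
    (∃ (lam : ℕ → ℝ) (φ : ℕ → ℝ → ℝ), P.IsEigensystem lam φ) ∧
    ∀ (lam : ℕ → ℝ) (φ : ℕ → ℝ → ℝ), P.IsEigensystem lam φ →
      (∀ n m, P.inn (φ n) (φ m) = if n = m then 1 else 0) ∧
      (∀ f : ℝ → ℝ, MemLp f 2 (volume.restrict TwoIntervalSL.J) →
        Tendsto
          (fun n : ℕ =>
            P.Δ₃₄ / P.p₁ * (∫ x in (-Real.pi)..0,
              (f x - ∑ k ∈ Finset.range (n + 1), P.inn f (φ k) * φ k x) ^ 2) +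
            P.Δ₁₂ / P.p₂ * ∫ x in (0 : ℝ)..Real.pi,
              (f x - ∑ k ∈ Finset.range (n + 1), P.inn f (φ k) * φ k x) ^ 2)
          atTop (𝓝 0)) ∧
      (∃ b : HilbertBasis ℕ ℝ (Lp ℝ 2 P.weight), ∀ n, b n =ᵐ[P.weight] φ n) := by
  refine ⟨TwoIntervalSL.Problem.exists_isEigensystem h12 h34, fun lam φ h => ⟨fun n m => ?_,
    fun f hf => ?_, ?_⟩⟩
  · split_ifs with hnm
    · rw [hnm, h.normalized]
    · exact TwoIntervalSL.Problem.inn_eq_zero_of_ne (h.solves n) (h.solves m) (h.injective.ne hnm)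
  · simpa only [TwoIntervalSL.Problem.inn, sq] using
      h.tendsto_partialSum h12 h34 (P.memLp_weight hf)
  · obtain ⟨b, hb⟩ := h.exists_hilbertBasis h12 h34
    exact ⟨b, fun n => by rw [hb]; exact (h.memLp n).coeFn_toLp⟩
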